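/- **Setting.** Let $U\subset\mathbb{R}^2$ be open and let $f:\mathbb{R}^2\to\mathbb{R}$ be of class $C^r$, $r>1$, with $0$ as a regular value. Put $\Sigma=f^{-1}(0)\cap U$, $\Sigma^+=\{q\in U: f(q)>0\}$, $\Sigma^-=\{q\in U: f(q)<0\}$. A non-smooth vector field (NSVF) $Z=(X,Y)$ consists of $C^r$ vector fields $X$ on $\overline{\Sigma^+}$ and $Y$ on $\overline{\Sigma^-}$ (closures in $U$; that is, they extend to $C^r$ fields on open sets containing these closures). Write $Xf=\langle\nabla f,X\rangle$, $X^2f=\langle\nabla(Xf),X\rangle$, and likewise for $Y$. On $\Sigma$ consider the crossing regions $\Sigma^{c+}=\{Xf>0,Yf>0\}$ and $\Sigma^{c-}=\{Xf<0,Yf<0\}$, the sliding region $\Sigma^s=\{Xf<0<Yf\}$, the escaping region $\Sigma^e=\{Yf<0<Xf\}$, and the tangency points, where $Xf\cdot Yf=0$. A tangency point is singular if $Xf=Yf=0$, $X^2f<0$ and $Y^2f>0$, and regular otherwise. The sliding vector field is $Z^s=\frac{Yf\cdot X-Xf\cdot Y}{Yf-Xf}$ on $\Sigma^s\cup\Sigma^e$,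 extended by continuity to those points of the closure of this set in $\Sigma$ at which the limit exists. A local trajectory starting at $p$ follows, on a time interval $[a,b]$: an orbit of $X$ in $\overline{\Sigma^+}$ if $p\in\Sigma^+\cup\Sigma^{c+}$; an orbit of $Y$ in $\overline{\Sigma^-}$ if $p\in\Sigma^-\cup\Sigma^{c-}$; an orbit of $Z^s$ if $p\in\Sigma^s$; any one of these three kinds of orbit if $p\in\Sigma^e$ or $p$ is a regular tangency point; and it stays at $p$ if $p$ is a singular tangency point. (Orbits of $Z^s$ do not pass through singular tangency points.) A global trajectory is a curve $\gamma:\mathbb{R}\to\mathbb{R}^2$ for which there are times $t_i<t_{i+1}$ ($i\in\mathbb{Z}$) with $t_i\to\pm\infty$ as $i\to\pm\infty$ such that $\gamma|_{[t_i,t_{i+1}]}$ is a local trajectory starting at $\gamma(t_i)$, for all $i$. A set is $Z$-invariant if it contains every global trajectory passing through one of its points. The trajectory $\gamma$ escapes at time $s_0$ to $\Sigma^{\pm}$ if $\gamma(s_0)\in\overline{\Sigma^e}$ and, for some $s_1>s_0$, $\gamma(s)\notin\overline{\Sigma^e}$ and $\gamma(s)\in\Sigma^{\pm}$ for all $s_0<s<s_1$.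 For a compact set $K\subset U$ let $\Omega$ be the set of global trajectories contained in $K$, with the metric $$\rho(\gamma_1,\gamma_2)=\sum_{i\in\mathbb{Z}}\frac1{2^{|i|}}\int_i^{i+1}|\gamma_1(t)-\gamma_2(t)|\,dt ,$$ and let $F_1:\Omega\to\Omega$, $F_1(\gamma)=\gamma(\cdot+1)$. The topological entropy of $Z$ on $K$ is $$h(Z)=h(F_1)=\lim_{\varepsilon\to0}\limsup_{n\to\infty}\frac1n\log S(\varepsilon,n)\in[-\infty,\infty],$$ where $S(\varepsilon,n)$ is the least cardinality of a set $E\subset\Omega$ such that every $\gamma\in\Omega$ satisfies $\max_{0\le i<n}\rho(F_1^i\gamma,F_1^i\eta)<\varepsilon$ for some $\eta\in E$ (and $S(\varepsilon,n)=\infty$ if no finite such $E$ exists). **Theorem.** Let $Z=(X,Y)$ be an NSVF as above and let $K\subset U$ be a compact $Z$-invariant set with $\Sigma^e\cap K\neq\emptyset$. Suppose that there is a (non-degenerate) closed interval $J\subset\Sigma^e\cap K$, that is, a subset homeomorphic to $[0,1]$, such that for every $x\in J$ there are a global trajectory $\gamma_x$ and times $s_0<s$ such that $\gamma_x(s_0)=x$,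 $\gamma_x$ escapes at time $s_0$ to $\Sigma^+$ or to $\Sigma^-$, and $\gamma_x(s)\in J$. Then $h(Z)=\infty$. -/

import Mathlib

open Set Filter Topology MeasureTheory TopologicalSpace

/-- The Euclidean plane. -/
abbrev Plane : Type := EuclideanSpace ℝ (Fin 2)

/-- The Lie derivative `W g (p) = ⟨∇ g (p), W (p)⟩` of a function along a planar vector field. -/
noncomputable def lieDeriv (W : Plane → Plane) (g : Plane → ℝ) (p : Plane) : ℝ :=
  inner ℝ (gradient g p) (W p)

/-- The part of `U` where `f` is positive. -/
def posRegion (U : Set Plane) (f : Plane → ℝ) : Set Plane := {q | q ∈ U ∧ 0 < f q}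

/-- The part of `U` where `f` is negative. -/
def negRegion (U : Set Plane) (f : Plane → ℝ) : Set Plane := {q | q ∈ U ∧ f q < 0}

/-- A planar non-smooth vector field `Z = (X, Y)` of class `C^r` on an open set `U`, with switching
manifold `f⁻¹(0) ∩ U`. The field `X` (resp. `Y`) only matters on the closure relative to `U` of
`{f > 0}` (resp. `{f < 0}`), and it is of class `C^r` there in the sense that it is `C^r` on an
open set containing that closure. -/
structure NSVF (r : ℕ∞) where
  U : Set Plane
  isOpen_U : IsOpen U
  f : Plane → ℝ
  contDiff_f : ContDiff ℝ r f
  regular_value : ∀ p, f p = 0 → gradient f p ≠ 0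
  X : Plane → Plane
  Y : Plane → Plane
  contDiff_X : ∃ V, IsOpen V ∧ closure (posRegion U f) ∩ U ⊆ V ∧ ContDiffOn ℝ r X V
  contDiff_Y : ∃ V, IsOpen V ∧ closure (negRegion U f) ∩ U ⊆ V ∧ ContDiffOn ℝ r Y V

namespace NSVF

variable {r : ℕ∞} (Z : NSVF r)

/-- `Σ⁺`. -/
def pos : Set Plane := posRegion Z.U Z.f

/-- `Σ⁻`. -/
def neg : Set Plane := negRegion Z.U Z.f

/-- The switching manifold `Σ`. -/
def switching : Set Plane := {q | q ∈ Z.U ∧ Z.f q = 0}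

/-- `X f`. -/
noncomputable def Xf : Plane → ℝ := lieDeriv Z.X Z.f

/-- `Y f`. -/
noncomputable def Yf : Plane → ℝ := lieDeriv Z.Y Z.f

/-- `Σ^{c+}`. -/
def crossingPos : Set Plane := {p | p ∈ Z.switching ∧ 0 < Z.Xf p ∧ 0 < Z.Yf p}

/-- `Σ^{c-}`. -/
def crossingNeg : Set Plane := {p | p ∈ Z.switching ∧ Z.Xf p < 0 ∧ Z.Yf p < 0}

/-- The sliding region `Σ^s`. -/
def sliding : Set Plane := {p | p ∈ Z.switching ∧ Z.Xf p < 0 ∧ 0 < Z.Yf p}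

/-- The escaping region `Σ^e`. -/
def escaping : Set Plane := {p | p ∈ Z.switching ∧ 0 < Z.Xf p ∧ Z.Yf p < 0}

/-- Tangency points. -/
def tangency : Set Plane := {p | p ∈ Z.switching ∧ Z.Xf p * Z.Yf p = 0}

/-- Singular tangency points: invisible folds of both fields. The orbit of `X` through an invisible
fold of `X` stays locally in `{f ≤ 0}` (`X² f < 0`), and the orbit of `Y` through an invisible fold
of `Y` stays locally in `{f ≥ 0}` (`Y² f > 0`). -/
def singularTangency : Set Plane :=
  {p | p ∈ Z.switching ∧ (Z.Xf p = 0 ∧ lieDeriv Z.X Z.Xf p < 0) ∧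
    (Z.Yf p = 0 ∧ 0 < lieDeriv Z.Y Z.Yf p)}

/-- Regular tangency points. -/
def regularTangency : Set Plane := Z.tangency \ Z.singularTangency

/-- The sliding vector field of Filippov's convention, meaningful on `Σ^s ∪ Σ^e`. -/
noncomputable def slidingField (p : Plane) : Plane :=
  (Z.Yf p - Z.Xf p)⁻¹ • (Z.Yf p • Z.X p - Z.Xf p • Z.Y p)

/-- `v` is the value at `p` of the sliding vector field extended by continuity from `Σ^s ∪ Σ^e` to
the closure of this set in `Σ`. -/
def IsSlidingValue (p v : Plane) : Prop :=
  p ∈ Z.switching ∧ p ∈ closure (Z.sliding ∪ Z.escaping) ∧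
    Tendsto Z.slidingField (𝓝[Z.sliding ∪ Z.escaping] p) (𝓝 v)

/-- On the time interval `[a, b]`, the curve `γ` is an orbit of `X` in the closure of `Σ⁺`. -/
def IsXArc (γ : ℝ → Plane) (a b : ℝ) : Prop :=
  ∀ t ∈ Icc a b, γ t ∈ closure Z.pos ∩ Z.U ∧ HasDerivWithinAt γ (Z.X (γ t)) (Icc a b) t

/-- On the time interval `[a, b]`, the curve `γ` is an orbit of `Y` in the closure of `Σ⁻`. -/
def IsYArc (γ : ℝ → Plane) (a b : ℝ) : Prop :=
  ∀ t ∈ Icc a b, γ t ∈ closure Z.neg ∩ Z.U ∧ HasDerivWithinAt γ (Z.Y (γ t)) (Icc a b) t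

/-- On the time interval `[a, b]`, the curve `γ` is an orbit of the (extended) sliding vector field.
It does not pass through singular tangency points, which are equilibria by convention. -/
def IsSlidingArc (γ : ℝ → Plane) (a b : ℝ) : Prop :=
  (∀ t ∈ Icc a b, ∃ v, Z.IsSlidingValue (γ t) v ∧ HasDerivWithinAt γ v (Icc a b) t) ∧
    ∀ t ∈ Ioo a b, γ t ∉ Z.singularTangency

/-- On the time interval `[a, b]`, the curve `γ` is a local trajectory of `Z` through `γ a` (taking
the origin of time at `a`). This is the part `t ≥ 0` of the usual convention. The
prescriptions of that convention on how a point of `Σ⁺`, `Σ⁻`, `Σ^c`, `Σ^s`, `Σ^e` may be reached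
hold for the end `γ b`, because an orbit of `X` (resp. `Y`) has to stay in the closure of `Σ⁺`
(resp. `Σ⁻`): for instance a point of `Σ^e` can only be reached by sliding. -/
inductive IsLocalTrajectory (γ : ℝ → Plane) (a b : ℝ) : Prop
  | pos : γ a ∈ Z.pos → Z.IsXArc γ a b → IsLocalTrajectory γ a b
  | neg : γ a ∈ Z.neg → Z.IsYArc γ a b → IsLocalTrajectory γ a b
  | crossingPos : γ a ∈ Z.crossingPos → Z.IsXArc γ a b → IsLocalTrajectory γ a b
  | crossingNeg : γ a ∈ Z.crossingNeg → Z.IsYArc γ a b → IsLocalTrajectory γ a b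
  | escaping : γ a ∈ Z.escaping →
      Z.IsXArc γ a b ∨ Z.IsYArc γ a b ∨ Z.IsSlidingArc γ a b → IsLocalTrajectory γ a b
  | sliding : γ a ∈ Z.sliding → Z.IsSlidingArc γ a b → IsLocalTrajectory γ a b
  | regularTangency : γ a ∈ Z.regularTangency →
      Z.IsXArc γ a b ∨ Z.IsYArc γ a b ∨ Z.IsSlidingArc γ a b → IsLocalTrajectory γ a b
  | singularTangency : γ a ∈ Z.singularTangency →
      (∀ t ∈ Icc a b, γ t = γ a) → IsLocalTrajectory γ a b

/-- A global trajectory: a bi-infinite concatenation of local trajectories, the `i`-th one run on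
the time interval `[t i, t (i + 1)]`, with `t i → ±∞` as `i → ±∞`. -/
def IsGlobalTrajectory (γ : ℝ → Plane) : Prop :=
  ∃ t : ℤ → ℝ, StrictMono t ∧ Tendsto t atTop atTop ∧ Tendsto t atBot atBot ∧
    ∀ i, Z.IsLocalTrajectory γ (t i) (t (i + 1))

/-- `A` is `Z`-invariant: every global trajectory through a point of `A` is contained in `A`. -/
def IsInvariant (A : Set Plane) : Prop :=
  ∀ p ∈ A, ∀ γ, Z.IsGlobalTrajectory γ → (∃ t, γ t = p) → ∀ t, γ t ∈ A

/-- At the time `s₀`, the trajectory `γ` escapes the closure of `Σ^e` to the region `R`. -/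
def EscapesTo (R : Set Plane) (γ : ℝ → Plane) (s₀ : ℝ) : Prop :=
  γ s₀ ∈ closure Z.escaping ∧
    ∃ s₁ > s₀, ∀ s ∈ Ioo s₀ s₁, γ s ∉ closure Z.escaping ∧ γ s ∈ R

/-- The space `Ω` of the global trajectories of `Z` contained in the compact set `K`. -/
def Orbits (K : Compacts Plane) : Type :=
  {γ : ℝ → Plane // Z.IsGlobalTrajectory γ ∧ ∀ t, γ t ∈ K}

variable {Z}

theorem IsLocalTrajectory.continuousOn {γ : ℝ → Plane} {a b : ℝ}
    (h : Z.IsLocalTrajectory γ a b) : ContinuousOn γ (Icc a b) := by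
  have hX : Z.IsXArc γ a b → ContinuousOn γ (Icc a b) :=
    fun h t ht => (h t ht).2.continuousWithinAt
  have hY : Z.IsYArc γ a b → ContinuousOn γ (Icc a b) :=
    fun h t ht => (h t ht).2.continuousWithinAt
  have hS : Z.IsSlidingArc γ a b → ContinuousOn γ (Icc a b) := by
    intro h t ht
    obtain ⟨v, -, hv⟩ := h.1 t ht
    exact hv.continuousWithinAt
  rcases h with ⟨-, h⟩ | ⟨-, h⟩ | ⟨-, h⟩ | ⟨-, h⟩ | ⟨-, h⟩ | ⟨-, h⟩ | ⟨-, h⟩ | ⟨-, h⟩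
  · exact hX h
  · exact hY h
  · exact hX h
  · exact hY h
  · rcases h with h | h | h
    exacts [hX h, hY h, hS h]
  · exact hS h
  · rcases h with h | h | h
    exacts [hX h, hY h, hS h]
  · exact continuousOn_const.congr h

theorem IsGlobalTrajectory.continuous {γ : ℝ → Plane} (h : Z.IsGlobalTrajectory γ) :
    Continuous γ := by
  obtain ⟨t, hmono, htop, hbot, hloc⟩ := h
  have key : ∀ m n : ℤ, m ≤ n → ContinuousOn γ (Icc (t m) (t n)) := by
    intro m n hmn
    induction n, hmn using Int.leInduction with
    | base => simp
    | succ n hmn ih =>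
      have h1 : t m ≤ t n := hmono.monotone hmn
      have h2 : t n ≤ t (n + 1) := hmono.monotone (by omega)
      rw [← Icc_union_Icc_eq_Icc h1 h2]
      exact ih.union_of_isClosed (hloc n).continuousOn isClosed_Icc isClosed_Icc
  rw [continuous_iff_continuousAt]
  intro s
  obtain ⟨n, hn0, hn⟩ := ((eventually_ge_atTop (0 : ℤ)).and
    (htop.eventually (eventually_gt_atTop s))).exists
  obtain ⟨m, hm0, hm⟩ := ((eventually_le_atBot (0 : ℤ)).and
    (hbot.eventually (eventually_lt_atBot s))).exists
  exact (key m n (hm0.trans hn0)).continuousAt (Icc_mem_nhds hm hn)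

theorem IsLocalTrajectory.shift {γ : ℝ → Plane} {a b : ℝ} (c : ℝ)
    (h : Z.IsLocalTrajectory γ a b) :
    Z.IsLocalTrajectory (fun t => γ (t + c)) (a - c) (b - c) := by
  have hmem : ∀ t ∈ Icc (a - c) (b - c), t + c ∈ Icc a b := by
    intro t ht
    exact ⟨by linarith [ht.1], by linarith [ht.2]⟩
  have hder : ∀ v t, t ∈ Icc (a - c) (b - c) → HasDerivWithinAt γ v (Icc a b) (t + c) →
      HasDerivWithinAt (fun t => γ (t + c)) v (Icc (a - c) (b - c)) t := by
    intro v t ht hv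
    have h1 : HasDerivWithinAt (fun t : ℝ => t + c) 1 (Icc (a - c) (b - c)) t :=
      (hasDerivWithinAt_id t _).add_const c
    have h2 := hv.scomp t h1 hmem
    rw [one_smul] at h2
    exact h2
  have hX : Z.IsXArc γ a b → Z.IsXArc (fun t => γ (t + c)) (a - c) (b - c) :=
    fun h t ht => ⟨(h _ (hmem t ht)).1, hder _ t ht (h _ (hmem t ht)).2⟩
  have hY : Z.IsYArc γ a b → Z.IsYArc (fun t => γ (t + c)) (a - c) (b - c) :=
    fun h t ht => ⟨(h _ (hmem t ht)).1, hder _ t ht (h _ (hmem t ht)).2⟩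
  have hS : Z.IsSlidingArc γ a b → Z.IsSlidingArc (fun t => γ (t + c)) (a - c) (b - c) := by
    intro h
    refine ⟨fun t ht => ?_, fun t ht => h.2 _ ⟨by linarith [ht.1], by linarith [ht.2]⟩⟩
    obtain ⟨v, hv, hv'⟩ := h.1 _ (hmem t ht)
    exact ⟨v, hv, hder v t ht hv'⟩
  have ha : γ (a - c + c) = γ a := by simp
  rcases h with ⟨h0, h⟩ | ⟨h0, h⟩ | ⟨h0, h⟩ | ⟨h0, h⟩ | ⟨h0, h⟩ | ⟨h0, h⟩ | ⟨h0, h⟩ | ⟨h0, h⟩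
  · exact .pos (by simpa only [ha] using h0) (hX h)
  · exact .neg (by simpa only [ha] using h0) (hY h)
  · exact .crossingPos (by simpa only [ha] using h0) (hX h)
  · exact .crossingNeg (by simpa only [ha] using h0) (hY h)
  · exact .escaping (by simpa only [ha] using h0) (h.imp hX (Or.imp hY hS))
  · exact .sliding (by simpa only [ha] using h0) (hS h)
  · exact .regularTangency (by simpa only [ha] using h0) (h.imp hX (Or.imp hY hS))
  · exact .singularTangency (by simpa only [ha] using h0) (fun t ht => by simpa only [ha] using h _ (hmem t ht))

theorem IsGlobalTrajectory.shift {γ : ℝ → Plane} (c : ℝ) (h : Z.IsGlobalTrajectory γ) :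
    Z.IsGlobalTrajectory (fun t => γ (t + c)) := by
  obtain ⟨t, hmono, htop, hbot, hloc⟩ := h
  refine ⟨fun i => t i - c, fun i j hij => sub_lt_sub_right (hmono hij) c, ?_, ?_,
    fun i => (hloc i).shift c⟩
  · simpa [sub_eq_add_neg] using tendsto_atTop_add_const_right _ (-c) htop
  · simpa [sub_eq_add_neg] using tendsto_atBot_add_const_right _ (-c) hbot

namespace Orbits

variable {K : Compacts Plane}

theorem continuous (γ : Z.Orbits K) : Continuous γ.1 := γ.2.1.continuous

/-- The distance `ρ` between two trajectories. -/
noncomputable def rho (γ₁ γ₂ : Z.Orbits K) : ℝ :=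
  ∑' i : ℤ, 1 / 2 ^ i.natAbs * ∫ t in (i : ℝ)..(i + 1), dist (γ₁.1 t) (γ₂.1 t)

theorem intervalIntegrable_dist (γ₁ γ₂ : Z.Orbits K) (a b : ℝ) :
    IntervalIntegrable (fun t => dist (γ₁.1 t) (γ₂.1 t)) volume a b :=
  (γ₁.continuous.dist γ₂.continuous).intervalIntegrable a b

theorem integral_dist_nonneg (γ₁ γ₂ : Z.Orbits K) (i : ℤ) :
    0 ≤ ∫ t in (i : ℝ)..(i + 1), dist (γ₁.1 t) (γ₂.1 t) :=
  intervalIntegral.integral_nonneg (by linarith) fun _ _ => dist_nonneg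

theorem summable_weights : Summable fun i : ℤ => (1 : ℝ) / 2 ^ i.natAbs := by
  have h : Summable fun n : ℕ => (1 : ℝ) / 2 ^ n := by
    simpa using summable_geometric_two
  exact Summable.of_nat_of_neg (by simpa using h) (by simpa using h)

theorem summable_rho (γ₁ γ₂ : Z.Orbits K) : Summable fun i : ℤ =>
    1 / 2 ^ i.natAbs * ∫ t in (i : ℝ)..(i + 1), dist (γ₁.1 t) (γ₂.1 t) := by
  refine Summable.of_nonneg_of_le
    (fun i => mul_nonneg (by positivity) (integral_dist_nonneg γ₁ γ₂ i)) (fun i => ?_)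
    (summable_weights.mul_right (Metric.diam (K : Set Plane)))
  refine mul_le_mul_of_nonneg_left ?_ (by positivity)
  calc ∫ t in (i : ℝ)..(i + 1), dist (γ₁.1 t) (γ₂.1 t)
      ≤ ∫ _ in (i : ℝ)..(i + 1), Metric.diam (K : Set Plane) :=
        intervalIntegral.integral_mono_on (by linarith) (intervalIntegrable_dist γ₁ γ₂ _ _)
          intervalIntegrable_const fun t _ =>
            Metric.dist_le_diam_of_mem K.isCompact.isBounded (γ₁.2.2 t) (γ₂.2.2 t)
    _ = Metric.diam (K : Set Plane) := by simp

noncomputable instance : MetricSpace (Z.Orbits K) where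
  dist := rho
  dist_self γ := by simp [rho]
  dist_comm γ₁ γ₂ := by simp only [rho, dist_comm]
  dist_triangle γ₁ γ₂ γ₃ := by
    simp only [rho]
    rw [← (summable_rho γ₁ γ₂).tsum_add (summable_rho γ₂ γ₃)]
    refine (summable_rho γ₁ γ₃).tsum_le_tsum (fun i => ?_)
      ((summable_rho γ₁ γ₂).add (summable_rho γ₂ γ₃))
    rw [← mul_add, ← intervalIntegral.integral_add (intervalIntegrable_dist γ₁ γ₂ _ _)
      (intervalIntegrable_dist γ₂ γ₃ _ _)]
    refine mul_le_mul_of_nonneg_left ?_ (by positivity)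
    exact intervalIntegral.integral_mono_on (by linarith) (intervalIntegrable_dist γ₁ γ₃ _ _)
      ((intervalIntegrable_dist γ₁ γ₂ _ _).add (intervalIntegrable_dist γ₂ γ₃ _ _))
      fun t _ => dist_triangle _ _ _
  eq_of_dist_eq_zero := by
    intro γ₁ γ₂ h
    have hnn : ∀ i : ℤ, 0 ≤ 1 / 2 ^ i.natAbs *
        ∫ t in (i : ℝ)..(i + 1), dist (γ₁.1 t) (γ₂.1 t) :=
      fun i => mul_nonneg (by positivity) (integral_dist_nonneg γ₁ γ₂ i)
    have hsum := (summable_rho γ₁ γ₂).hasSum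
    have h' : rho γ₁ γ₂ = 0 := h
    rw [rho] at h'
    rw [h'] at hsum
    have h0 := (hasSum_zero_iff_of_nonneg hnn).1 hsum
    have hcont : Continuous fun t => dist (γ₁.1 t) (γ₂.1 t) :=
      γ₁.continuous.dist γ₂.continuous
    refine Subtype.ext (funext fun s => ?_)
    by_contra hne
    have hint : ∫ t in ((⌊s⌋ : ℤ) : ℝ)..(⌊s⌋ + 1), dist (γ₁.1 t) (γ₂.1 t) = 0 := by
      have := congrFun h0 ⌊s⌋
      simpa using this
    have hpos : 0 < ∫ t in ((⌊s⌋ : ℤ) : ℝ)..(⌊s⌋ + 1), dist (γ₁.1 t) (γ₂.1 t) :=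
      intervalIntegral.integral_pos (by linarith) hcont.continuousOn (fun _ _ => dist_nonneg)
        ⟨s, ⟨Int.floor_le s, (Int.lt_floor_add_one s).le⟩, dist_pos.2 hne⟩
    exact hpos.ne' hint

/-- The time-one map `F₁ (γ) = γ (· + 1)`. -/
def timeOne (γ : Z.Orbits K) : Z.Orbits K :=
  ⟨fun t => γ.1 (t + 1), γ.2.1.shift 1, fun t => γ.2.2 (t + 1)⟩

end Orbits

variable (Z)

/-- The topological entropy `h(Z)` of `Z` on `K`: the topological entropy of the time-one map on the
metric space `(Ω, ρ)`. Mathlib's `Dynamics.coverEntropy` is the supremum over the entourages `E` of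
`limsup (log S(E, n)) / n`, where `S(E, n)` is the least cardinality of an `(n, E)`-dense set; since
the entourages `{ρ < ε}` form a basis, it is the limit as `ε → 0` of the growth rates of the
`ε`-capacities. -/
noncomputable def entropy (K : Compacts Plane) : EReal :=
  Dynamics.coverEntropy (Orbits.timeOne : Z.Orbits K → Z.Orbits K) univ

end NSVF

namespace NSVF

variable {r : ℕ∞} {Z : NSVF r}

/-! ### Restriction and congruence of local trajectories -/

/-! On `Σ^e` both fields point away from `Σ` into their own side, so a trajectory can arrive at an
escaping point only along an orbit of `Z^s` (`IsLocalTrajectory.isSlidingArc`). Take a trajectory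
that escapes from a point of `J` and later returns to `J`, and let `u` be the supremum of the times
before the return at which it is off `J`. At time `u` it lies on `J`, having slid in from outside.
By ODE uniqueness the sliding field does not vanish there, so the point is an end of `J` and the
sliding flow enters `J` through it (`exists_return_to_end`, by way of
`arc_end_of_frequently_notMem`). Thus from every point of `J` one can escape and reach one of the
two ends, an end from which an orbit slides into `J`. A case distinction on the ends gives one
sliding orbit `σ : [0, δ] → J` such that from each `σ t` with `t > 0` one can escape and come back
to `σ 0` (`exists_recurrent_sliding_orbit`).

Since a trajectory may leave `Σ^e` at any moment, each `t ∈ (0, δ]` yields a loop at `σ 0`: slide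
until time `t`, escape, return. For `t < t'` the two loops differ just after time `t`, when the
first is off `Σ^e` and the second still slides (`IsLoop.exists_separated`). There are uncountably
many `t` and each loop has finite duration, so infinitely many loops last at most a common time `M`.
Take `N` of them. Every word of length `k` in these loops is realized by a global trajectory, which
lies in `K` by invariance, and distinct words are separated before time `k * M`
(`exists_orbits_of_words`). Hence the entropy is at least `log N / M`, with `M` independent of `N`,
so it is infinite (`coverEntropy_eq_top_of_words`). -/

theorem IsXArc.mono {γ : ℝ → Plane} {a b c d : ℝ} (h : Z.IsXArc γ a b)
    (hs : Icc c d ⊆ Icc a b) : Z.IsXArc γ c d :=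
  fun t ht => ⟨(h t (hs ht)).1, (h t (hs ht)).2.mono hs⟩

theorem IsYArc.mono {γ : ℝ → Plane} {a b c d : ℝ} (h : Z.IsYArc γ a b)
    (hs : Icc c d ⊆ Icc a b) : Z.IsYArc γ c d :=
  fun t ht => ⟨(h t (hs ht)).1, (h t (hs ht)).2.mono hs⟩

theorem IsSlidingArc.mono {γ : ℝ → Plane} {a b c d : ℝ} (h : Z.IsSlidingArc γ a b)
    (hac : a ≤ c) (hdb : d ≤ b) : Z.IsSlidingArc γ c d := by
  refine ⟨fun t ht => ?_, fun t ht => h.2 t (Ioo_subset_Ioo hac hdb ht)⟩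
  obtain ⟨v, hv, hv'⟩ := h.1 t (Icc_subset_Icc hac hdb ht)
  exact ⟨v, hv, hv'.mono (Icc_subset_Icc hac hdb)⟩

theorem IsXArc.congr {γ η : ℝ → Plane} {a b : ℝ} (h : Z.IsXArc γ a b)
    (he : EqOn η γ (Icc a b)) : Z.IsXArc η a b := fun t ht => by
  rw [he ht]
  exact ⟨(h t ht).1, (h t ht).2.congr he (he ht)⟩

theorem IsYArc.congr {γ η : ℝ → Plane} {a b : ℝ} (h : Z.IsYArc γ a b)
    (he : EqOn η γ (Icc a b)) : Z.IsYArc η a b := fun t ht => by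
  rw [he ht]
  exact ⟨(h t ht).1, (h t ht).2.congr he (he ht)⟩

theorem IsSlidingArc.congr {γ η : ℝ → Plane} {a b : ℝ} (h : Z.IsSlidingArc γ a b)
    (he : EqOn η γ (Icc a b)) : Z.IsSlidingArc η a b := by
  refine ⟨fun t ht => ?_, fun t ht => ?_⟩
  · obtain ⟨v, hv, hv'⟩ := h.1 t ht
    exact ⟨v, by rwa [he ht], hv'.congr he (he ht)⟩
  · rw [he (Ioo_subset_Icc_self ht)]
    exact h.2 t ht

theorem IsLocalTrajectory.congr {γ η : ℝ → Plane} {a b : ℝ} (hab : a ≤ b)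
    (h : Z.IsLocalTrajectory γ a b) (he : EqOn η γ (Icc a b)) : Z.IsLocalTrajectory η a b := by
  have ha : η a = γ a := he (left_mem_Icc.2 hab)
  rcases h with ⟨h0, h⟩ | ⟨h0, h⟩ | ⟨h0, h⟩ | ⟨h0, h⟩ | ⟨h0, h⟩ | ⟨h0, h⟩ | ⟨h0, h⟩ | ⟨h0, h⟩ <;>
    rw [← ha] at h0
  · exact .pos h0 (h.congr he)
  · exact .neg h0 (h.congr he)
  · exact .crossingPos h0 (h.congr he)
  · exact .crossingNeg h0 (h.congr he)
  · exact .escaping h0 (h.imp (·.congr he) (Or.imp (·.congr he) (·.congr he)))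
  · exact .sliding h0 (h.congr he)
  · exact .regularTangency h0 (h.imp (·.congr he) (Or.imp (·.congr he) (·.congr he)))
  · exact .singularTangency h0 fun t ht => by rw [he ht, ha, h t ht]

theorem IsLocalTrajectory.mono_right {γ : ℝ → Plane} {a b d : ℝ}
    (h : Z.IsLocalTrajectory γ a b) (hd : d ≤ b) : Z.IsLocalTrajectory γ a d := by
  have hs : Icc a d ⊆ Icc a b := Icc_subset_Icc_right hd
  rcases h with ⟨h0, h⟩ | ⟨h0, h⟩ | ⟨h0, h⟩ | ⟨h0, h⟩ | ⟨h0, h⟩ | ⟨h0, h⟩ | ⟨h0, h⟩ | ⟨h0, h⟩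
  · exact .pos h0 (h.mono hs)
  · exact .neg h0 (h.mono hs)
  · exact .crossingPos h0 (h.mono hs)
  · exact .crossingNeg h0 (h.mono hs)
  · exact .escaping h0 (h.imp (·.mono hs) (Or.imp (·.mono hs) (·.mono le_rfl hd)))
  · exact .sliding h0 (h.mono le_rfl hd)
  · exact .regularTangency h0 (h.imp (·.mono hs) (Or.imp (·.mono hs) (·.mono le_rfl hd)))
  · exact .singularTangency h0 fun t ht => h t (hs ht)

theorem escaping_disjoint_singularTangency {p : Plane} (hp : p ∈ Z.escaping) :
    p ∉ Z.singularTangency := fun h => hp.2.1.ne' h.2.1.1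

/-- A local trajectory may be restarted at any of its escaping points. -/
theorem IsLocalTrajectory.mono_left {γ : ℝ → Plane} {a b c : ℝ}
    (h : Z.IsLocalTrajectory γ a b) (hc : c ∈ Icc a b) (he : γ c ∈ Z.escaping) :
    Z.IsLocalTrajectory γ c b := by
  have hs : Icc c b ⊆ Icc a b := Icc_subset_Icc_left hc.1
  -- At an escaping start all three kinds of orbit are allowed, so the type of the original piece is
  -- irrelevant.
  refine .escaping he ?_
  rcases h with ⟨h0, h⟩ | ⟨h0, h⟩ | ⟨h0, h⟩ | ⟨h0, h⟩ | ⟨h0, h⟩ | ⟨h0, h⟩ | ⟨h0, h⟩ | ⟨h0, h⟩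
  · exact .inl (h.mono hs)
  · exact .inr (.inl (h.mono hs))
  · exact .inl (h.mono hs)
  · exact .inr (.inl (h.mono hs))
  · exact h.imp (·.mono hs) (Or.imp (·.mono hs) (·.mono hc.1 le_rfl))
  · exact .inr (.inr (h.mono hc.1 le_rfl))
  · exact h.imp (·.mono hs) (Or.imp (·.mono hs) (·.mono hc.1 le_rfl))
  · exact absurd (h c hc ▸ h0) (escaping_disjoint_singularTangency he)

/-! ### Finite concatenations of local trajectories -/

/-- On `[a, b]`, the curve `γ` is a finite concatenation of local trajectories. -/
inductive Chain (Z : NSVF r) (γ : ℝ → Plane) (a : ℝ) : ℝ → Prop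
  | single {b : ℝ} : a < b → Z.IsLocalTrajectory γ a b → Chain Z γ a b
  | snoc {b c : ℝ} : Chain Z γ a b → b < c → Z.IsLocalTrajectory γ b c → Chain Z γ a c

theorem Chain.lt {γ : ℝ → Plane} {a b : ℝ} (h : Chain Z γ a b) : a < b := by
  induction h with
  | single h _ => exact h
  | snoc _ h _ ih => exact ih.trans h

theorem Chain.trans {γ : ℝ → Plane} {a b c : ℝ} (h : Chain Z γ a b) (h' : Chain Z γ b c) :
    Chain Z γ a c := by
  induction h' with
  | single h1 h2 => exact h.snoc h1 h2
  | snoc _ h1 h2 ih => exact ih.snoc h1 h2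

theorem Chain.congr {γ η : ℝ → Plane} {a b : ℝ} (h : Chain Z γ a b)
    (he : EqOn η γ (Icc a b)) : Chain Z η a b := by
  induction h with
  | single h1 h2 => exact .single h1 (h2.congr h1.le he)
  | snoc h0 h1 h2 ih =>
    exact .snoc (ih (he.mono (Icc_subset_Icc_right h1.le))) h1
      (h2.congr h1.le (he.mono (Icc_subset_Icc_left h0.lt.le)))

theorem Chain.shift {γ : ℝ → Plane} {a b : ℝ} (c : ℝ) (h : Chain Z γ a b) :
    Chain Z (fun t => γ (t + c)) (a - c) (b - c) := by
  induction h with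
  | single h1 h2 => exact .single (by linarith) (h2.shift c)
  | snoc h0 h1 h2 ih => exact .snoc ih (by linarith) (h2.shift c)

theorem Chain.continuousOn {γ : ℝ → Plane} {a b : ℝ} (h : Chain Z γ a b) :
    ContinuousOn γ (Icc a b) := by
  induction h with
  | single h1 h2 => exact h2.continuousOn
  | snoc h0 h1 h2 ih =>
    rw [← Icc_union_Icc_eq_Icc h0.lt.le h1.le]
    exact ih.union_of_isClosed h2.continuousOn isClosed_Icc isClosed_Icc

/-- The break points of a chain. -/
theorem Chain.exists_breakpoints {γ : ℝ → Plane} {a b : ℝ} (h : Chain Z γ a b) :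
    ∃ S : Set ℝ, S.Finite ∧ S ⊆ Icc a b ∧ a ∈ S ∧ b ∈ S ∧
      ∀ x ∈ S, x < b → ∃ y ∈ S, x < y ∧ (∀ z ∈ S, x < z → y ≤ z) ∧
        Z.IsLocalTrajectory γ x y := by
  induction h with
  | @single b h1 h2 =>
    refine ⟨{a, b}, by simp, ?_, by simp, by simp, ?_⟩
    · rintro x (rfl | rfl)
      exacts [left_mem_Icc.2 h1.le, right_mem_Icc.2 h1.le]
    · rintro x (rfl | rfl) hx
      · refine ⟨b, by simp, hx, ?_, h2⟩
        rintro z (rfl | rfl) hz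
        exacts [absurd hz (lt_irrefl _), le_rfl]
      · exact absurd hx (lt_irrefl _)
  | @snoc b c h0 h1 h2 ih =>
    obtain ⟨S, hf, hsub, ha, hb, hS⟩ := ih
    refine ⟨insert c S, hf.insert c, ?_, .inr ha, .inl rfl, ?_⟩
    · rintro x (rfl | hx)
      exacts [right_mem_Icc.2 (h0.lt.trans h1).le, Icc_subset_Icc_right h1.le (hsub hx)]
    · rintro x (rfl | hx) hxc
      · exact absurd hxc (lt_irrefl _)
      · rcases (hsub hx).2.lt_or_eq with hxb | rfl
        · obtain ⟨y, hy, hxy, hyz, hl⟩ := hS x hx hxb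
          refine ⟨y, .inr hy, hxy, ?_, hl⟩
          rintro z (rfl | hz) hxz
          exacts [(hsub hy).2.trans h1.le, hyz z hz hxz]
        · refine ⟨c, .inl rfl, hxc, ?_, h2⟩
          rintro z (rfl | hz) hxz
          exacts [le_rfl, absurd hxz (hsub hz).2.not_gt]

/-- A strictly increasing bi-infinite sequence of times splits the line into half-open
intervals. -/
theorem exists_mem_Ico_of_tendsto {τ : ℤ → ℝ} (htop : Tendsto τ atTop atTop)
    (hbot : Tendsto τ atBot atBot) (hmono : StrictMono τ) (s : ℝ) :
    ∃ k, s ∈ Ico (τ k) (τ (k + 1)) := by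
  obtain ⟨m, hm⟩ := (hbot.eventually (eventually_le_atBot s)).exists
  obtain ⟨n, hn⟩ := (htop.eventually (eventually_gt_atTop s)).exists
  obtain ⟨k, hk, hk'⟩ := Int.exists_greatest_of_bdd (P := fun k => τ k ≤ s)
    ⟨n, fun k hk => hmono.le_iff_le.1 (hk.trans hn.le)⟩ ⟨m, hm⟩
  exact ⟨k, hk, not_le.1 fun h => absurd (hk' _ h) (by omega)⟩

/-- A curve with an unbounded, locally finite set of break points is a global trajectory. -/
theorem isGlobalTrajectory_of_breakpoints {γ : ℝ → Plane} {B : Set ℝ}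
    (hfin : ∀ a b, (B ∩ Icc a b).Finite) (htop : ∀ x, ∃ b ∈ B, x < b)
    (hbot : ∀ x, ∃ b ∈ B, b < x)
    (hB : ∀ x ∈ B, ∃ y ∈ B, x < y ∧ (∀ z ∈ B, x < z → y ≤ z) ∧ Z.IsLocalTrajectory γ x y) :
    Z.IsGlobalTrajectory γ := by
  -- A nonempty, locally finite linear order without ends is isomorphic to `ℤ`; this isomorphism
  -- enumerates the break times.
  let : LocallyFiniteOrder B := LocallyFiniteOrder.ofFiniteIcc fun a b => by
    refine Set.Finite.of_finite_image ((hfin a b).subset ?_) Subtype.val_injective.injOn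
    rintro _ ⟨x, hx, rfl⟩
    exact ⟨x.2, hx⟩
  let : SuccOrder B := LinearLocallyFiniteOrder.succOrder B
  let : PredOrder B := LinearLocallyFiniteOrder.predOrder B
  have : NoMaxOrder B := ⟨fun a => let ⟨b, hb, h⟩ := htop a; ⟨⟨b, hb⟩, h⟩⟩
  have : NoMinOrder B := ⟨fun a => let ⟨b, hb, h⟩ := hbot a; ⟨⟨b, hb⟩, h⟩⟩
  have : Nonempty B := let ⟨b, hb, _⟩ := htop 0; ⟨⟨b, hb⟩⟩
  let φ : B ≃o ℤ := orderIsoIntOfLinearSuccPredArch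
  have hmono : StrictMono fun i : ℤ => (φ.symm i : ℝ) := fun i j h => φ.symm.strictMono h
  refine ⟨fun i => φ.symm i, hmono, ?_, ?_, fun i => ?_⟩
  · refine tendsto_atTop_atTop_of_monotone hmono.monotone fun x => ?_
    obtain ⟨b, hb, h⟩ := htop x
    exact ⟨φ ⟨b, hb⟩, by simpa using h.le⟩
  · refine tendsto_atBot_atBot_of_monotone hmono.monotone fun x => ?_
    obtain ⟨b, hb, h⟩ := hbot x
    exact ⟨φ ⟨b, hb⟩, by simpa using h.le⟩
  · obtain ⟨y, hy, hlt, hmin, hl⟩ := hB _ (φ.symm i).2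
    have h1 : y ≤ φ.symm (i + 1) := hmin _ (φ.symm (i + 1)).2 (hmono (by simp))
    have h2 : φ.symm (i + 1) ≤ ⟨y, hy⟩ := by
      exact φ.symm_apply_le.2 (Int.add_one_le_iff.2 (φ.symm_apply_lt.1 hlt))
    have h3 : y = φ.symm (i + 1) := le_antisymm h1 h2
    rw [h3] at hl
    exact hl

/-- A bi-infinite concatenation of chains is a global trajectory. -/
theorem isGlobalTrajectory_of_chains {γ : ℝ → Plane} {τ : ℤ → ℝ}
    (htop : Tendsto τ atTop atTop) (hbot : Tendsto τ atBot atBot)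
    (hch : ∀ k, Chain Z γ (τ k) (τ (k + 1))) : Z.IsGlobalTrajectory γ := by
  have hmono : StrictMono τ := strictMono_int_of_lt_succ fun k => (hch k).lt
  choose S hf hsub hl hr hS using fun k => (hch k).exists_breakpoints
  -- Break points of different blocks interfere only at common ends of the blocks.
  have hloc : ∀ {k z}, z ∈ S k → ∀ m, τ m ≤ z → z < τ (m + 1) → z ∈ S m := by
    intro k z hz m h1 h2
    have hk := hsub k hz
    rcases lt_trichotomy k m with h | rfl | h
    · have : τ (k + 1) ≤ τ m := hmono.monotone (by omega)
      have h3 : z = τ m := le_antisymm (hk.2.trans this) h1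
      exact h3 ▸ hl m
    · exact hz
    · have : τ (m + 1) ≤ τ k := hmono.monotone (by omega)
      exact absurd (this.trans hk.1) h2.not_ge
  refine isGlobalTrajectory_of_breakpoints (B := ⋃ k, S k) (fun a b => ?_) (fun x => ?_)
    (fun x => ?_) fun x hx => ?_
  · obtain ⟨m, hm, -⟩ := exists_mem_Ico_of_tendsto htop hbot hmono a
    obtain ⟨n, -, hn⟩ := exists_mem_Ico_of_tendsto htop hbot hmono b
    refine ((Set.finite_Icc m n).biUnion fun k _ => hf k).subset ?_
    rintro x ⟨hx, hax, hxb⟩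
    obtain ⟨k, hk⟩ := mem_iUnion.1 hx
    obtain ⟨l, hl1, hl2⟩ := exists_mem_Ico_of_tendsto htop hbot hmono x
    refine mem_biUnion (x := l) ⟨?_, ?_⟩ (hloc hk l hl1 hl2)
    · have := hmono.lt_iff_lt.1 ((hm.trans hax).trans_lt hl2)
      omega
    · have := hmono.lt_iff_lt.1 ((hl1.trans hxb).trans_lt hn)
      omega
  · obtain ⟨k, hk⟩ := (htop.eventually (eventually_gt_atTop x)).exists
    exact ⟨τ k, mem_iUnion.2 ⟨k, hl k⟩, hk⟩
  · obtain ⟨k, hk⟩ := (hbot.eventually (eventually_lt_atBot x)).exists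
    exact ⟨τ k, mem_iUnion.2 ⟨k, hl k⟩, hk⟩
  · obtain ⟨k, hk⟩ := mem_iUnion.1 hx
    obtain ⟨l, hl1, hl2⟩ := exists_mem_Ico_of_tendsto htop hbot hmono x
    obtain ⟨y, hy, hxy, hmin, hlt⟩ := hS l x (hloc hk l hl1 hl2) hl2
    refine ⟨y, mem_iUnion.2 ⟨l, hy⟩, hxy, fun z hz hxz => ?_, hlt⟩
    obtain ⟨j, hj⟩ := mem_iUnion.1 hz
    rcases lt_or_ge z (τ (l + 1)) with h | h
    · exact hmin z (hloc hj l (hl1.trans hxz.le) h) hxz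
    · exact (hsub l hy).2.trans h

/-- Between two times, the first one at an escaping point, a global trajectory is a chain. -/
theorem IsGlobalTrajectory.chain {γ : ℝ → Plane} (h : Z.IsGlobalTrajectory γ) {a b : ℝ}
    (hab : a < b) (ha : γ a ∈ Z.escaping) : Chain Z γ a b := by
  obtain ⟨t, hmono, htop, hbot, hloc⟩ := h
  obtain ⟨m, hm⟩ := exists_mem_Ico_of_tendsto htop hbot hmono a
  have hst : Z.IsLocalTrajectory γ a (t (m + 1)) :=
    (hloc m).mono_left ⟨hm.1, hm.2.le⟩ ha
  have key : ∀ n : ℤ, m + 1 ≤ n → Chain Z γ a (t n) := by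
    intro n hn
    induction n, hn using Int.leInduction with
    | base => exact .single hm.2 hst
    | succ n hmn ih => exact ih.snoc (hmono (by omega)) (hloc n)
  obtain ⟨n, hn⟩ := exists_mem_Ico_of_tendsto htop hbot hmono b
  rcases le_or_gt b (t (m + 1)) with hb | hb
  · exact .single hab (hst.mono_right hb)
  · have hmn : m + 1 ≤ n := by
      have := hmono.lt_iff_lt.1 (hb.trans hn.2)
      omega
    rcases hn.1.lt_or_eq with h | h
    · exact (key n hmn).snoc h ((hloc n).mono_right hn.2.le)
    · exact h ▸ key n hmn

/-- Bi-infinite concatenation of loops at a point. -/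
theorem exists_concatenation {c : ℤ → ℝ → Plane} {T : ℤ → ℝ} {e : Plane} {m : ℝ} (hm : 0 < m)
    (hT : ∀ k, m ≤ T k) (h0 : ∀ k, c k 0 = e) (h1 : ∀ k, c k (T k) = e)
    (hc : ∀ k, Chain Z (c k) 0 (T k)) :
    ∃ γ : ℝ → Plane, ∃ τ : ℤ → ℝ, Z.IsGlobalTrajectory γ ∧ τ 0 = 0 ∧
      (∀ k, τ (k + 1) = τ k + T k) ∧ ∀ k, ∀ s ∈ Icc 0 (T k), γ (τ k + s) = c k s := by
  -- Signed partial sums: for each sign of `k` one of the two sums is empty.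
  let τ : ℤ → ℝ := fun k => ∑ i ∈ Finset.Ico 0 k, T i - ∑ i ∈ Finset.Ico k 0, T i
  have hτ : ∀ k, τ (k + 1) = τ k + T k := by
    intro k
    simp only [τ]
    rcases le_or_gt 0 k with hk | hk
    · rw [Finset.Ico_eq_empty_of_le (a := k + 1) (by omega), Finset.Ico_eq_empty_of_le hk,
        ← Finset.insert_Ico_right_eq_Ico_add_one hk, Finset.sum_insert (by simp)]
      ring
    · rw [Finset.Ico_eq_empty_of_le (a := 0) (b := k + 1) (by omega),
        Finset.Ico_eq_empty_of_le hk.le, ← Finset.insert_Ico_add_one_left_eq_Ico hk,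
        Finset.sum_insert (by simp)]
      ring
  have hτ0 : τ 0 = 0 := by simp [τ]
  have hmono : StrictMono τ := strictMono_int_of_lt_succ fun k => by
    rw [hτ]; linarith [hT k]
  have hge : ∀ n : ℕ, n * m ≤ τ n := by
    intro n
    induction n with
    | zero => simp [hτ0]
    | succ n ih => push_cast; rw [hτ]; linarith [hT n]
  have hle : ∀ n : ℕ, τ (-n) ≤ -(n * m) := by
    intro n
    induction n with
    | zero => simp [hτ0]
    | succ n ih =>
      have h := hτ (-(n + 1 : ℕ))
      rw [show (-((n + 1 : ℕ) : ℤ) + 1) = -n by push_cast; ring] at h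
      push_cast at h ⊢
      linarith [hT (-(n + 1))]
  have htop : Tendsto τ atTop atTop := by
    refine tendsto_atTop_atTop_of_monotone hmono.monotone fun x => ?_
    obtain ⟨n, hn⟩ := exists_nat_ge (x / m)
    exact ⟨n, ((div_le_iff₀ hm).1 hn).trans (hge n)⟩
  have hbot : Tendsto τ atBot atBot := by
    refine tendsto_atBot_atBot_of_monotone hmono.monotone fun x => ?_
    obtain ⟨n, hn⟩ := exists_nat_ge (-x / m)
    exact ⟨-n, (hle n).trans (by linarith [(div_le_iff₀ hm).1 hn])⟩
  choose κ hκ using exists_mem_Ico_of_tendsto htop hbot hmono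
  let γ : ℝ → Plane := fun s => c (κ s) (s - τ (κ s))
  have hγ : ∀ k, ∀ s ∈ Icc 0 (T k), γ (τ k + s) = c k s := by
    intro k s hs
    have hk := hκ (τ k + s)
    rcases hs.2.lt_or_eq with h | h
    · have hkk : κ (τ k + s) = k := by
        have h1 := hmono.lt_iff_lt.1 (hk.1.trans_lt (by linarith [hτ k] : τ k + s < τ (k + 1)))
        have h2 := hmono.lt_iff_lt.1 ((by linarith [hs.1] : τ k ≤ τ k + s).trans_lt hk.2)
        omega
      simp only [γ, hkk, add_sub_cancel_left]
    -- The right end of block `k` is read off as the start of block `k + 1`; both values are `e`.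
    · have hkk : κ (τ k + s) = k + 1 := by
        rw [h, ← hτ] at hk ⊢
        have h1 := hmono.le_iff_le.1 hk.1
        have h2 := hmono.lt_iff_lt.1 hk.2
        omega
      simp only [γ, hkk]
      rw [hτ, h, sub_self, h0, h1]
  refine ⟨γ, τ, isGlobalTrajectory_of_chains htop hbot fun k => ?_, hτ0, hτ, hγ⟩
  have := (hc k).shift (-τ k)
  rw [zero_sub, neg_neg, sub_neg_eq_add, add_comm, ← hτ] at this
  refine this.congr fun t ht => ?_
  have := hγ k (t - τ k) ⟨by linarith [ht.1], by linarith [ht.2, hτ k]⟩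
  simpa [sub_eq_add_neg] using this

end NSVF

namespace NSVF

variable {r : ℕ∞} {Z : NSVF r}

/-! ### Local geometry of the escaping region -/

theorem differentiable_f (hr : 1 < r) : Differentiable ℝ Z.f :=
  Z.contDiff_f.differentiable (by
    have : r ≠ 0 := fun h => by simp [h] at hr
    exact_mod_cast this)

theorem two_le_coe (hr : 1 < r) : (2 : WithTop ℕ∞) ≤ r := by
  have : (2 : ℕ∞) ≤ r := by simpa [one_add_one_eq_two] using Order.add_one_le_of_lt hr
  exact WithTop.coe_le_coe.2 this

theorem hasDerivWithinAt_f (hr : 1 < r) {γ : ℝ → Plane} {v : Plane} {s : Set ℝ} {t : ℝ}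
    (h : HasDerivWithinAt γ v s t) :
    HasDerivWithinAt (fun t => Z.f (γ t)) (inner ℝ (gradient Z.f (γ t)) v) s t := by
  have h1 := (Z.differentiable_f hr (γ t)).hasGradientAt.hasFDerivAt
  have h2 := h1.comp_hasDerivWithinAt t h
  rwa [InnerProductSpace.toDual_apply_apply] at h2

/-- Along the line through `p` in the direction of the gradient, `f` has derivative `‖∇f p‖² > 0` at
`p`. This places `Σ` in the closures of both sides, where `X` and `Y` are known to be smooth. -/
theorem exists_curve_through_switching (hr : 1 < r) {p : Plane} (hp : p ∈ Z.switching) :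
    ∃ c : ℝ → Plane, Continuous c ∧ c 0 = p ∧
      (∀ᶠ s in 𝓝[>] 0, c s ∈ Z.pos) ∧ ∀ᶠ s in 𝓝[<] 0, c s ∈ Z.neg := by
  set g := gradient Z.f p
  have hg : g ≠ 0 := Z.regular_value p hp.2
  let c : ℝ → Plane := fun s => p + s • g
  have hc : Continuous c := by fun_prop
  have hc0 : c 0 = p := by simp [c]
  have hd : HasDerivAt c g 0 := by
    have := ((hasDerivAt_id (0 : ℝ)).smul_const g).const_add p
    rwa [one_smul] at this
  have hU : ∀ᶠ s in 𝓝 (0 : ℝ), c s ∈ Z.U :=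
    hc.continuousAt.eventually_mem (Z.isOpen_U.mem_nhds (by rw [hc0]; exact hp.1))
  have hf := Z.hasDerivWithinAt_f hr hd.hasDerivWithinAt (s := univ)
  rw [hc0, hasDerivWithinAt_univ, hasDerivAt_iff_tendsto_slope] at hf
  have hpos : 0 < inner ℝ g g := real_inner_self_pos.2 hg
  have hs := hf.eventually (eventually_gt_nhds hpos)
  have hs1 := hs.filter_mono (nhdsWithin_mono (0 : ℝ) (fun x (hx : x ∈ Ioi 0) => ne_of_gt hx))
  have hs2 := hs.filter_mono (nhdsWithin_mono (0 : ℝ) (fun x (hx : x ∈ Iio 0) => ne_of_lt hx))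
  refine ⟨c, hc, hc0, ?_, ?_⟩
  · filter_upwards [hs1, hU.filter_mono nhdsWithin_le_nhds, self_mem_nhdsWithin] with s h1 h2 h3
    refine ⟨h2, ?_⟩
    rw [slope_def_field, hc0, hp.2, sub_zero, sub_zero] at h1
    exact (div_pos_iff_of_pos_right h3).1 h1
  · filter_upwards [hs2, hU.filter_mono nhdsWithin_le_nhds, self_mem_nhdsWithin] with s h1 h2 h3
    refine ⟨h2, ?_⟩
    rw [slope_def_field, hc0, hp.2, sub_zero, sub_zero] at h1
    by_contra h4
    exact absurd h1 (not_lt.2 (div_nonpos_of_nonneg_of_nonpos (not_lt.1 h4) (le_of_lt h3)))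

theorem switching_subset_closure_pos (hr : 1 < r) : Z.switching ⊆ closure Z.pos := by
  intro p hp
  obtain ⟨c, hc, hc0, h, -⟩ := exists_curve_through_switching hr hp
  exact mem_closure_of_tendsto (b := 𝓝[>] (0 : ℝ))
    (hc0 ▸ hc.continuousAt.tendsto.mono_left nhdsWithin_le_nhds) h

theorem switching_subset_closure_neg (hr : 1 < r) : Z.switching ⊆ closure Z.neg := by
  intro p hp
  obtain ⟨c, hc, hc0, -, h⟩ := exists_curve_through_switching hr hp
  exact mem_closure_of_tendsto (b := 𝓝[<] (0 : ℝ))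
    (hc0 ▸ hc.continuousAt.tendsto.mono_left nhdsWithin_le_nhds) h

theorem contDiffAt_X (hr : 1 < r) {p : Plane} (hp : p ∈ Z.switching) :
    ContDiffAt ℝ 1 Z.X p := by
  obtain ⟨V, hV, hsub, h⟩ := Z.contDiff_X
  exact (h.contDiffAt (hV.mem_nhds (hsub ⟨switching_subset_closure_pos hr hp, hp.1⟩))).of_le
    (by exact_mod_cast hr.le)

theorem contDiffAt_Y (hr : 1 < r) {p : Plane} (hp : p ∈ Z.switching) :
    ContDiffAt ℝ 1 Z.Y p := by
  obtain ⟨V, hV, hsub, h⟩ := Z.contDiff_Y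
  exact (h.contDiffAt (hV.mem_nhds (hsub ⟨switching_subset_closure_neg hr hp, hp.1⟩))).of_le
    (by exact_mod_cast hr.le)

theorem contDiff_gradient (hr : 1 < r) : ContDiff ℝ 1 (gradient Z.f) := by
  have h : ContDiff ℝ 1 (fderiv ℝ Z.f) :=
    Z.contDiff_f.fderiv_right (by rw [one_add_one_eq_two]; exact two_le_coe hr)
  exact (InnerProductSpace.toDual ℝ Plane).symm.contDiff.comp h

theorem contDiffAt_Xf (hr : 1 < r) {p : Plane} (hp : p ∈ Z.switching) :
    ContDiffAt ℝ 1 Z.Xf p :=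
  (contDiff_gradient hr).contDiffAt.inner ℝ (contDiffAt_X hr hp)

theorem contDiffAt_Yf (hr : 1 < r) {p : Plane} (hp : p ∈ Z.switching) :
    ContDiffAt ℝ 1 Z.Yf p :=
  (contDiff_gradient hr).contDiffAt.inner ℝ (contDiffAt_Y hr hp)

/-- The denominator `Yf - Xf` is negative on `Σ^e`. The `C¹` regularity supplies existence and
uniqueness for sliding orbits. -/
theorem contDiffAt_slidingField (hr : 1 < r) {p : Plane} (hp : p ∈ Z.escaping) :
    ContDiffAt ℝ 1 Z.slidingField p := by
  have hX := contDiffAt_Xf hr hp.1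
  have hY := contDiffAt_Yf hr hp.1
  have h : Z.Yf p - Z.Xf p ≠ 0 := by linarith [hp.2.1, hp.2.2]
  exact ((hY.sub hX).inv h).smul
    ((hY.smul (contDiffAt_X hr hp.1)).sub (hX.smul (contDiffAt_Y hr hp.1)))

/-- The cancellation `Yf * Xf - Xf * Yf = 0` holds at every point of the plane, not only on `Σ`. So
`f` is constant along solutions before they are known to stay in `Σ`. -/
theorem inner_gradient_slidingField (p : Plane) :
    inner ℝ (gradient Z.f p) (Z.slidingField p) = 0 := by
  have h1 : inner ℝ (gradient Z.f p) (Z.X p) = Z.Xf p := rfl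
  have h2 : inner ℝ (gradient Z.f p) (Z.Y p) = Z.Yf p := rfl
  rw [slidingField, inner_smul_right, inner_sub_right, inner_smul_right, inner_smul_right, h1, h2]
  ring

/-- The escaping region is open in the switching manifold. -/
theorem eventually_mem_escaping (hr : 1 < r) {p : Plane} (hp : p ∈ Z.escaping) :
    ∀ᶠ q in 𝓝 p, q ∈ Z.switching → q ∈ Z.escaping := by
  filter_upwards [(contDiffAt_Xf hr hp.1).continuousAt.eventually (eventually_gt_nhds hp.2.1),
    (contDiffAt_Yf hr hp.1).continuousAt.eventually (eventually_lt_nhds hp.2.2)] with q h1 h2 h3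
  exact ⟨h3, h1, h2⟩

theorem isSlidingValue_slidingField (hr : 1 < r) {p : Plane} (hp : p ∈ Z.escaping) :
    Z.IsSlidingValue p (Z.slidingField p) :=
  ⟨hp.1, subset_closure (.inr hp),
    (contDiffAt_slidingField hr hp).continuousAt.tendsto.mono_left nhdsWithin_le_nhds⟩

theorem IsSlidingValue.eq_slidingField (hr : 1 < r) {p v : Plane} (hp : p ∈ Z.escaping)
    (h : Z.IsSlidingValue p v) : v = Z.slidingField p := by
  have : (𝓝[Z.sliding ∪ Z.escaping] p).NeBot := mem_closure_iff_nhdsWithin_neBot.1 h.2.1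
  exact tendsto_nhds_unique h.2.2 (isSlidingValue_slidingField hr hp).2.2

theorem isSlidingArc_of_hasDerivWithinAt (hr : 1 < r) {γ : ℝ → Plane} {a b : ℝ}
    (he : ∀ t ∈ Icc a b, γ t ∈ Z.escaping)
    (h : ∀ t ∈ Icc a b, HasDerivWithinAt γ (Z.slidingField (γ t)) (Icc a b) t) :
    Z.IsSlidingArc γ a b :=
  ⟨fun t ht => ⟨_, isSlidingValue_slidingField hr (he t ht), h t ht⟩,
    fun t ht => escaping_disjoint_singularTangency (he t (Ioo_subset_Icc_self ht))⟩

/-- A differentiable function on `[a, b]` has a nonpositive derivative at a minimum over `[a, t]`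
attained at the right end `t`. -/
theorem deriv_nonpos_of_min_right {g : ℝ → ℝ} {g' a b t : ℝ} (ht : t ∈ Ioc a b)
    (hg : HasDerivWithinAt g g' (Icc a b) t) (hmin : ∀ s ∈ Icc a t, g t ≤ g s) : g' ≤ 0 := by
  have h := (hg.mono (Ioo_subset_Icc_self.trans (Icc_subset_Icc_right ht.2)) :
    HasDerivWithinAt g g' (Ioo a t) t)
  rw [hasDerivWithinAt_iff_tendsto_slope' right_notMem_Ioo] at h
  have : (𝓝[Ioo a t] t).NeBot := by
    rw [nhdsWithin_Ioo_eq_nhdsLT ht.1]; infer_instance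
  refine le_of_tendsto h ?_
  filter_upwards [self_mem_nhdsWithin] with s hs
  rw [slope_def_field]
  exact div_nonpos_of_nonneg_of_nonpos (sub_nonneg.2 (hmin s (Ioo_subset_Icc_self hs)))
    (sub_nonpos.2 hs.2.le)

/-- An escaping point can only be reached by sliding. -/
theorem IsLocalTrajectory.isSlidingArc (hr : 1 < r) {γ : ℝ → Plane} {a b t : ℝ}
    (h : Z.IsLocalTrajectory γ a b) (ht : t ∈ Ioc a b) (he : γ t ∈ Z.escaping) :
    Z.IsSlidingArc γ a b := by
  have hcl : IsClosed {q | 0 ≤ Z.f q} := isClosed_le continuous_const Z.contDiff_f.continuous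
  have hcl' : IsClosed {q | Z.f q ≤ 0} := isClosed_le Z.contDiff_f.continuous continuous_const
  -- On an `X`-arc `f ∘ γ ≥ 0`, with the minimum `0` at `t`; its derivative there would be
  -- nonpositive, against `Xf > 0`. The `Y` case is symmetric.
  have hX : ¬ Z.IsXArc γ a b := by
    intro hX
    have hd := Z.hasDerivWithinAt_f hr (hX t (Ioc_subset_Icc_self ht)).2
    refine absurd (deriv_nonpos_of_min_right ht hd fun s hs => ?_) (not_le.2 he.2.1)
    rw [he.1.2]
    exact closure_minimal (fun q hq => hq.2.le) hcl (hX s ⟨hs.1, hs.2.trans ht.2⟩).1.1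
  have hY : ¬ Z.IsYArc γ a b := by
    intro hY
    have hd := (Z.hasDerivWithinAt_f hr (hY t (Ioc_subset_Icc_self ht)).2).neg
    refine absurd (deriv_nonpos_of_min_right ht hd fun s hs => ?_)
      (not_le.2 (neg_pos.2 he.2.2))
    rw [Pi.neg_apply, Pi.neg_apply, he.1.2, neg_zero, neg_nonneg]
    exact closure_minimal (fun q hq => hq.2.le) hcl' (hY s ⟨hs.1, hs.2.trans ht.2⟩).1.1
  rcases h with ⟨h0, h⟩ | ⟨h0, h⟩ | ⟨h0, h⟩ | ⟨h0, h⟩ | ⟨h0, h⟩ | ⟨h0, h⟩ | ⟨h0, h⟩ | ⟨h0, h⟩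
  · exact absurd h hX
  · exact absurd h hY
  · exact absurd h hX
  · exact absurd h hY
  · exact (h.resolve_left hX).resolve_left hY
  · exact h
  · exact (h.resolve_left hX).resolve_left hY
  · exact absurd (h t (Ioc_subset_Icc_self ht) ▸ h0) (escaping_disjoint_singularTangency he)

/-- A global trajectory reaches an escaping point along an orbit of the sliding vector field. -/
theorem IsGlobalTrajectory.exists_sliding_left (hr : 1 < r) {γ : ℝ → Plane}
    (h : Z.IsGlobalTrajectory γ) {u : ℝ} (hu : γ u ∈ Z.escaping) :
    ∃ a < u, ∀ t ∈ Icc a u, γ t ∈ Z.escaping ∧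
      HasDerivWithinAt γ (Z.slidingField (γ t)) (Icc a u) t := by
  have hcont := h.continuous
  obtain ⟨τ, hmono, htop, hbot, hloc⟩ := h
  -- The interval is open on the left, so that `u` is reached by the piece rather than being its
  -- start.
  obtain ⟨k, hk⟩ : ∃ k, u ∈ Ioc (τ k) (τ (k + 1)) := by
    obtain ⟨k, hk⟩ := exists_mem_Ico_of_tendsto htop hbot hmono u
    rcases hk.1.lt_or_eq with h | h
    · exact ⟨k, h, hk.2.le⟩
    · exact ⟨k - 1, h ▸ hmono (by omega), by simp [h]⟩
  have hs := (hloc k).isSlidingArc hr hk hu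
  have hev : ∀ᶠ t in 𝓝[<] u, ∀ s ∈ Icc t u, γ s ∈ Z.switching → γ s ∈ Z.escaping := by
    obtain ⟨δ, hδ, hb⟩ := Metric.eventually_nhds_iff.1
      (hcont.continuousAt.eventually (eventually_mem_escaping hr hu))
    filter_upwards [Ioo_mem_nhdsLT (sub_lt_self u hδ)] with t ht s hs
    exact hb (by rw [Real.dist_eq, abs_lt]; constructor <;> linarith [ht.1, hs.1, hs.2])
  obtain ⟨a, ha, ha'⟩ := (hev.and (Ioo_mem_nhdsLT hk.1)).exists
  refine ⟨a, ha'.2, fun t ht => ?_⟩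
  obtain ⟨v, hv, hv'⟩ := hs.1 t ⟨ha'.1.le.trans ht.1, ht.2.trans hk.2⟩
  have hte := ha t ht hv.1
  exact ⟨hte, hv.eq_slidingField hr hte ▸ hv'.mono (Icc_subset_Icc ha'.1.le hk.2)⟩

/-- The sliding vector field does not vanish at a point reached by a nonconstant sliding orbit. -/
theorem slidingField_ne_zero (hr : 1 < r) {γ : ℝ → Plane} {a u : ℝ} (hau : a < u)
    (h : ∀ t ∈ Icc a u, HasDerivWithinAt γ (Z.slidingField (γ t)) (Icc a u) t)
    (hu : γ u ∈ Z.escaping) (hne : ∃ᶠ t in 𝓝[<] u, γ t ≠ γ u) : Z.slidingField (γ u) ≠ 0 := by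
  intro h0
  obtain ⟨L, s, hs, hL⟩ := (contDiffAt_slidingField hr hu).exists_lipschitzOnWith
  have hcont : ContinuousOn γ (Icc a u) := fun t ht => (h t ht).continuousWithinAt
  have hmem : ∀ᶠ t in 𝓝[Icc a u] u, γ t ∈ s :=
    (hcont u (right_mem_Icc.2 hau.le)).eventually_mem hs
  rw [nhdsWithin_Icc_eq_nhdsLE hau] at hmem
  obtain ⟨b, hb, hbs⟩ := mem_nhdsLE_iff_exists_Icc_subset.1 hmem
  set c := max a b
  have hcu : c < u := max_lt hau hb
  have hsub : Icc c u ⊆ Icc a u := Icc_subset_Icc_left (le_max_left _ _)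
  -- If the field vanished at `γ u`, the constant curve would be a solution with the same final
  -- value; backward uniqueness makes `γ` constant before `u`.
  have hEq : EqOn γ (fun _ => γ u) (Icc c u) := by
    refine ODE_solution_unique_of_mem_Icc_left (v := fun _ => Z.slidingField)
      (s := fun _ => s) (K := L) (fun _ _ => hL) (hcont.mono hsub) (fun t ht => ?_)
      (fun t ht => hbs ⟨(le_max_right _ _).trans ht.1.le, ht.2⟩) continuousOn_const
      (fun t ht => ?_) (fun t ht => mem_of_mem_nhds hs) rfl
    · have := (h t (hsub (Ioc_subset_Icc_self ht))).mono (Icc_subset_Icc_right ht.2)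
      exact this.mono_of_mem_nhdsWithin (Icc_mem_nhdsLE ((le_max_left _ _).trans_lt ht.1))
    · rw [h0]; exact hasDerivWithinAt_const _ _ _
  obtain ⟨t, ht, ht'⟩ := (hne.and_eventually (Ioo_mem_nhdsLT hcu)).exists
  exact ht (hEq (Ioo_subset_Icc_self ht'))

/-- Near a point of the switching manifold, the projection to the tangent line is injective on the
switching manifold. -/
theorem exists_injOn_inner (hr : 1 < r) {p w : Plane} (hp : p ∈ Z.switching) (hw : w ≠ 0)
    (hgw : inner ℝ (gradient Z.f p) w = 0) :
    ∃ N ∈ 𝓝 p, InjOn (fun q => inner ℝ w q) (N ∩ Z.switching) := by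
  set g := gradient Z.f p
  have hg : g ≠ 0 := Z.regular_value p hp.2
  have hst : HasStrictFDerivAt Z.f (fderiv ℝ Z.f p) p :=
    Z.contDiff_f.contDiffAt.hasStrictFDerivAt (by
      have : r ≠ 0 := fun h => by simp [h] at hr
      exact_mod_cast this)
  have happ : ∀ d, fderiv ℝ Z.f p d = inner ℝ g d := fun d => by
    rw [(Z.differentiable_f hr p).hasGradientAt.hasFDerivAt.fderiv]; simp [g]
  have hpos : 0 < ‖g‖ / 2 := half_pos (norm_pos_iff.2 hg)
  have hlit := (hst.isLittleO.def hpos)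
  -- Strict differentiability with constant `‖g‖ / 2` bounds `|⟪g, q - q'⟫|` by `‖g‖ / 2 * ‖q - q'‖`
  -- for two zeros `q`, `q'` of `f` near `p`.
  rw [nhds_prod_eq] at hlit
  obtain ⟨N, hN, hNN⟩ := mem_prod_self_iff.1 hlit
  refine ⟨N, hN, fun q hq q' hq' heq => ?_⟩
  have h1 := hNN (mk_mem_prod hq.1 hq'.1)
  simp only [mem_ofPred_eq, happ, hq.2.2, hq'.2.2, sub_zero, zero_sub, Real.norm_eq_abs] at h1
  set d := q - q' with hd
  have hwd : inner ℝ w d = 0 := by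
    rw [hd, inner_sub_right, sub_eq_zero]; exact heq
  -- In the plane `g` and `d`, both orthogonal to `w ≠ 0`, are parallel. Equality in Cauchy–Schwarz
  -- then contradicts the bound above unless `d = 0`.
  have hpar : |inner ℝ g d| = ‖g‖ * ‖d‖ := by
    have e1 : g 0 * w 0 + g 1 * w 1 = 0 := by
      simpa [PiLp.inner_apply, Fin.sum_univ_two, mul_comm] using hgw
    have e2 : w 0 * d 0 + w 1 * d 1 = 0 := by
      simpa [PiLp.inner_apply, Fin.sum_univ_two, mul_comm] using hwd
    have e3 : g 0 * d 1 - g 1 * d 0 = 0 := by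
      by_contra hne
      have f0 : w 0 = 0 := by
        have : w 0 * (g 0 * d 1 - g 1 * d 0) = 0 := by linear_combination d 1 * e1 - g 1 * e2
        exact (mul_eq_zero.1 this).resolve_right hne
      have f1 : w 1 = 0 := by
        have : w 1 * (g 0 * d 1 - g 1 * d 0) = 0 := by linear_combination g 0 * e2 - d 0 * e1
        exact (mul_eq_zero.1 this).resolve_right hne
      exact hw (by ext i; fin_cases i <;> simp [f0, f1])
    rw [← abs_of_nonneg (mul_nonneg (norm_nonneg g) (norm_nonneg d)), ← sq_eq_sq_iff_abs_eq_abs,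
      mul_pow, EuclideanSpace.real_norm_sq_eq, EuclideanSpace.real_norm_sq_eq]
    simp only [PiLp.inner_apply, Fin.sum_univ_two, RCLike.inner_apply, conj_trivial]
    linear_combination (-(g 0 * d 1 - g 1 * d 0)) * e3
  rw [abs_neg, hpar] at h1
  have : ‖d‖ ≤ 0 := by nlinarith [norm_nonneg d]
  exact sub_eq_zero.1 (norm_le_zero_iff.1 this)

end NSVF

/-! ### Arcs in a set which a continuous function parametrizes locally -/

section Arc

variable {S J N : Set Plane} {π : Plane → ℝ} {h : unitInterval ≃ₜ J} {t₀ : unitInterval}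

/-- By the intermediate value theorem the arc takes every value of `π` in between, and by
injectivity any nearby point of `S` with such a value is the point of the arc. -/
theorem mem_arc_of_mem_uIcc (hπ : Continuous π) (hinj : InjOn π (N ∩ S)) (hJ : J ⊆ S)
    {t₁ : unitInterval} (ht : ∀ t ∈ uIcc t₀ t₁, (h t : Plane) ∈ N) {y : ℝ}
    (hy : y ∈ uIcc (π (h t₀)) (π (h t₁))) :
    ∃ t ∈ uIcc t₀ t₁, π (h t) = y ∧ ∀ q ∈ N ∩ S, π q = y → q = h t := by
  have hc : Continuous fun t => π (h t) := hπ.comp (continuous_subtype_val.comp h.continuous)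
  obtain ⟨t, htt, hty⟩ := intermediate_value_uIcc hc.continuousOn hy
  exact ⟨t, htt, hty, fun q hq hqy => hinj hq ⟨ht t htt, hJ (h t).2⟩ (hqy.trans hty.symm)⟩

/-- A curve in `S` which reaches the arc `J` at time `u`, being outside `J` at times arbitrarily
close to `u`, does so at an end of `J`, and `J` contains a neighbourhood in `S` of this end on the
other side. -/
theorem arc_end_of_frequently_notMem (hπ : Continuous π) (hN : N ∈ 𝓝 (h t₀ : Plane))
    (hinj : InjOn π (N ∩ S)) (hJ : J ⊆ S) {γ : ℝ → Plane} {u : ℝ} (hγ : ContinuousAt γ u)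
    (hu : γ u = h t₀) (hS : ∀ᶠ t in 𝓝[<] u, γ t ∈ S)
    (hlt : ∀ᶠ t in 𝓝[<] u, π (γ t) < π (h t₀)) (hnot : ∃ᶠ t in 𝓝[<] u, γ t ∉ J) :
    (t₀ = 0 ∨ t₀ = 1) ∧
      ∃ c > π (h t₀), ∀ q ∈ N ∩ S, π (h t₀) ≤ π q → π q ≤ c → q ∈ J := by
  have hh : Continuous fun t => (h t : Plane) := continuous_subtype_val.comp h.continuous
  have hhinj : Function.Injective fun t => (h t : Plane) :=
    Subtype.val_injective.comp h.injective
  have hnear : ∀ᶠ t₁ in 𝓝 t₀, ∀ t ∈ uIcc t₀ t₁, (h t : Plane) ∈ N := by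
    obtain ⟨ε, hε, hb⟩ := Metric.eventually_nhds_iff.1 (hh.continuousAt.eventually_mem hN)
    filter_upwards [Metric.ball_mem_nhds t₀ hε] with t₁ ht₁ t ht
    refine hb (lt_of_le_of_lt ?_ ht₁)
    rw [Subtype.dist_eq, Subtype.dist_eq, Real.dist_eq, Real.dist_eq]
    refine abs_sub_left_of_mem_uIcc ?_
    rcases le_total t₀ t₁ with h' | h'
    · rw [uIcc_of_le h'] at ht
      rw [uIcc_of_le (by exact_mod_cast h')]
      exact ⟨ht.1, ht.2⟩
    · rw [uIcc_of_ge h'] at ht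
      rw [uIcc_of_ge (by exact_mod_cast h')]
      exact ⟨ht.1, ht.2⟩
  -- If the arc took a smaller value of `π` near `t₀`, it would fill the values just below `π (h
  -- t₀)`, which `γ` takes before `u`; then `γ` would already be in `J`.
  have hgt : ∀ᶠ t₁ in 𝓝 t₀, t₁ ≠ t₀ → π (h t₀) < π (h t₁) := by
    filter_upwards [hnear] with t₁ ht₁ hne
    by_contra hle
    rcases (not_lt.1 hle).lt_or_eq with hlt' | heq
    · have h1 : ∀ᶠ t in 𝓝[<] u, γ t ∈ N :=
        (hγ.eventually_mem (hu ▸ hN)).filter_mono nhdsWithin_le_nhds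
      have h2 : ∀ᶠ t in 𝓝[<] u, π (h t₁) < π (γ t) := by
        have := (hπ.continuousAt.comp hγ).eventually (lt_mem_nhds (a := π (h t₁)) (by
          rw [Function.comp_apply, hu]; exact hlt'))
        exact this.filter_mono nhdsWithin_le_nhds
      obtain ⟨t, ht, hS, hlt, h1, h2⟩ :=
        (hnot.and_eventually (hS.and (hlt.and (h1.and h2)))).exists
      obtain ⟨s, -, -, hs⟩ := mem_arc_of_mem_uIcc hπ hinj hJ ht₁ (y := π (γ t))
        (by rw [uIcc_of_ge hlt'.le]; exact ⟨h2.le, hlt.le⟩)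
      exact ht (hs (γ t) ⟨h1, hS⟩ rfl ▸ (h s).2)
    · exact hne (hhinj (hinj ⟨ht₁ _ right_mem_uIcc, hJ (h t₁).2⟩
        ⟨ht₁ _ left_mem_uIcc, hJ (h t₀).2⟩ heq))
  constructor
  -- At an interior parameter the arc would rise above `π (h t₀)` on both sides and so take a common
  -- value twice, against injectivity.
  · by_contra! hne
    have h0 : 0 < t₀ := lt_of_le_of_ne unitInterval.nonneg' hne.1.symm
    have h1 : t₀ < 1 := lt_of_le_of_ne unitInterval.le_one' hne.2
    have : (𝓝[<] t₀).NeBot := nhdsLT_neBot_of_exists_lt ⟨0, h0⟩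
    have : (𝓝[>] t₀).NeBot := nhdsGT_neBot_of_exists_gt ⟨1, h1⟩
    obtain ⟨t₁, ⟨hn₁, hg₁⟩, hl₁⟩ := (((hnear.and hgt).filter_mono nhdsWithin_le_nhds).and
      (self_mem_nhdsWithin : Iio t₀ ∈ 𝓝[<] t₀)).exists
    obtain ⟨t₂, ⟨hn₂, hg₂⟩, hl₂⟩ := (((hnear.and hgt).filter_mono nhdsWithin_le_nhds).and
      (self_mem_nhdsWithin : Ioi t₀ ∈ 𝓝[>] t₀)).exists
    replace hg₁ := hg₁ (ne_of_lt hl₁)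
    replace hg₂ := hg₂ (ne_of_gt hl₂)
    obtain ⟨a, ha, hay, haq⟩ := mem_arc_of_mem_uIcc hπ hinj hJ hn₁
      (y := min (π (h t₁)) (π (h t₂)))
      (by rw [uIcc_of_le hg₁.le]; exact ⟨(lt_min hg₁ hg₂).le, min_le_left _ _⟩)
    obtain ⟨b, hb, hby, -⟩ := mem_arc_of_mem_uIcc hπ hinj hJ hn₂
      (y := min (π (h t₁)) (π (h t₂)))
      (by rw [uIcc_of_le hg₂.le]; exact ⟨(lt_min hg₁ hg₂).le, min_le_right _ _⟩)
    have hab : b = a := hhinj (haq _ ⟨hn₂ b hb, hJ (h b).2⟩ hby)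
    rw [uIcc_of_ge (le_of_lt hl₁)] at ha
    rw [uIcc_of_le (le_of_lt hl₂)] at hb
    have hat : a = t₀ := le_antisymm ha.2 (hab ▸ hb.1)
    rw [hat] at hay
    exact (lt_min hg₁ hg₂).ne hay
  · obtain ⟨t₁, ⟨hn₁, hg₁⟩, hne⟩ := (((hnear.and hgt).filter_mono nhdsWithin_le_nhds).and
      (self_mem_nhdsWithin : {t₀}ᶜ ∈ 𝓝[≠] t₀)).exists
    replace hg₁ := hg₁ hne
    refine ⟨_, hg₁, fun q hq h1 h2 => ?_⟩
    obtain ⟨s, -, -, hs⟩ := mem_arc_of_mem_uIcc hπ hinj hJ hn₁ (y := π q)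
      (by rw [uIcc_of_le hg₁.le]; exact ⟨h1, h2⟩)
    exact hs q hq rfl ▸ (h s).2

end Arc

/-! ### Sliding orbits entering the arc through its ends -/

namespace NSVF

variable {r : ℕ∞} {Z : NSVF r}

/-- There is an orbit of the sliding vector field in the escaping region through any of its
points. -/
theorem exists_sliding_orbit (hr : 1 < r) {p : Plane} (hp : p ∈ Z.escaping) :
    ∃ σ : ℝ → Plane, σ 0 = p ∧ ∃ δ > 0, ∀ t ∈ Icc 0 δ, σ t ∈ Z.escaping ∧
      HasDerivAt σ (Z.slidingField (σ t)) t := by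
  obtain ⟨ρ, hρ, ε, hε, H⟩ := (contDiffAt_slidingField hr hp
    ).exists_forall_mem_closedBall_exists_eq_forall_mem_Ioo_hasDerivAt 0
  obtain ⟨σ, hσ0, hσ⟩ := H p (Metric.mem_closedBall_self hρ.le)
  rw [zero_sub, zero_add] at hσ
  have hc : ContinuousAt σ 0 := (hσ 0 ⟨by linarith, hε⟩).continuousAt
  have hev : ∀ᶠ t in 𝓝 (0 : ℝ), σ t ∈ Z.U ∧ (σ t ∈ Z.switching → σ t ∈ Z.escaping) := by
    rw [← hσ0] at hp
    exact (hc.eventually_mem (Z.isOpen_U.mem_nhds hp.1.1)).and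
      (hc.eventually (eventually_mem_escaping hr hp))
  obtain ⟨η, hη, hη'⟩ := Metric.eventually_nhds_iff.1 hev
  have hδ : 0 < min ε η / 2 := half_pos (lt_min hε hη)
  have hlt : min ε η / 2 < min ε η := half_lt_self (lt_min hε hη)
  have hIoo : ∀ t ∈ Icc 0 (min ε η / 2), t ∈ Ioo (-ε) ε := fun t ht =>
    ⟨by linarith [ht.1], (ht.2.trans_lt hlt).trans_le (min_le_left _ _)⟩
  refine ⟨σ, hσ0, min ε η / 2, hδ, fun t ht => ⟨?_, hσ t (hIoo t ht)⟩⟩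
  -- The solution is one in the plane; tangency of the field to the level sets of `f` keeps it in
  -- `Σ`.
  have hf : Z.f (σ t) = Z.f (σ 0) := by
    refine constant_of_has_deriv_right_zero (f := fun t => Z.f (σ t)) (fun s hs => ?_)
      (fun s hs => ?_) t ht
    · exact (Z.contDiff_f.continuous.continuousAt.comp
        (hσ s (hIoo s hs)).continuousAt).continuousWithinAt
    · have := Z.hasDerivWithinAt_f hr (s := Ici s)
        (hσ s (hIoo s (Ico_subset_Icc_self hs))).hasDerivWithinAt
      rwa [inner_gradient_slidingField] at this
  have hd : dist t 0 < η := by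
    rw [Real.dist_eq, sub_zero, abs_of_nonneg ht.1]
    exact (ht.2.trans_lt hlt).trans_le (min_le_right _ _)
  exact (hη' hd).2 ⟨(hη' hd).1, by rw [hf, hσ0]; exact hp.1.2⟩

/-- An orbit of the sliding vector field starts at `e`, and stays in `J` for some time. -/
def IsSlidingStart (Z : NSVF r) (J : Set Plane) (e : Plane) : Prop :=
  ∃ σ : ℝ → Plane, σ 0 = e ∧ ∃ δ > 0, Z.IsSlidingArc σ 0 δ ∧ ∀ t ∈ Icc 0 δ, σ t ∈ J

/-- There is a chain from `p` to `q`, which leaves the escaping region immediately. -/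
def ReachesByEscape (Z : NSVF r) (p q : Plane) : Prop :=
  ∃ c : ℝ → Plane, ∃ T, Chain Z c 0 T ∧ c 0 = p ∧ c T = q ∧
    ∃ s > 0, ∀ t ∈ Ioo 0 s, c t ∉ Z.escaping

theorem reachesByEscape_of_isGlobalTrajectory {γ : ℝ → Plane} (hγ : Z.IsGlobalTrajectory γ)
    {a b : ℝ} (hab : a < b) (ha : γ a ∈ Z.escaping)
    (hs : ∃ s > a, ∀ t ∈ Ioo a s, γ t ∉ Z.escaping) : Z.ReachesByEscape (γ a) (γ b) := by
  obtain ⟨s, hs, h⟩ := hs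
  have hc := (hγ.chain hab ha).shift a
  rw [sub_self] at hc
  exact ⟨_, _, hc, by simp, by simp, s - a, by linarith,
    fun t ht => h _ ⟨by linarith [ht.1], by linarith [ht.2]⟩⟩

/-- A trajectory which escapes from a point of the arc `J` and returns to `J` does so through an
end of `J`, at which a sliding orbit enters `J`. -/
theorem exists_return_to_end (hr : 1 < r) {J : Set Plane} (h : unitInterval ≃ₜ J)
    (hJe : J ⊆ Z.escaping) {γ : ℝ → Plane} (hγ : Z.IsGlobalTrajectory γ) {s₀ s : ℝ}
    (hs₀ : γ s₀ ∈ J) (hesc : ∃ s₁ > s₀, ∀ t ∈ Ioo s₀ s₁, γ t ∉ Z.escaping) (hs : s₀ < s)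
    (hsJ : γ s ∈ J) :
    ∃ e : Plane, (e = h 0 ∨ e = h 1) ∧ Z.IsSlidingStart J e ∧ Z.ReachesByEscape (γ s₀) e := by
  have hcont : Continuous γ := hγ.continuous
  have hJc : IsClosed J :=
    (isCompact_iff_compactSpace.2 h.compactSpace).isClosed
  -- The times off `J`; the escape makes `A` nonempty. As `J` is closed, `γ` is on `J` at `u = sSup
  -- A`, but not throughout any left neighbourhood of `u`.
  set A := {t | t ∈ Icc s₀ s ∧ γ t ∉ J} with hA
  have hAb : BddAbove A := ⟨s, fun t ht => ht.1.2⟩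
  obtain ⟨s₁, hs₁, hout⟩ := hesc
  obtain ⟨v, hv⟩ := nonempty_Ioo.2 (lt_min hs₁ hs)
  have hvA : v ∈ A := ⟨⟨hv.1.le, (hv.2.trans_le (min_le_right _ _)).le⟩,
    fun hvJ => hout v ⟨hv.1, hv.2.trans_le (min_le_left _ _)⟩ (hJe hvJ)⟩
  set u := sSup A with hu
  have hvu : v ≤ u := le_csSup hAb hvA
  have hs₀u : s₀ < u := hv.1.trans_le hvu
  have hus : u ≤ s := csSup_le ⟨v, hvA⟩ fun t ht => ht.1.2
  have hafter : ∀ t ∈ Ioc u s, γ t ∈ J := by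
    intro t ht
    by_contra htJ
    exact absurd (le_csSup hAb (show t ∈ A from ⟨⟨hs₀u.le.trans ht.1.le, ht.2⟩, htJ⟩))
      (not_le.2 ht.1)
  have huJ : γ u ∈ J := by
    rcases hus.lt_or_eq with hlt | heq
    · refine hJc.mem_of_tendsto (b := 𝓝[>] u)
        (hcont.continuousAt.tendsto.mono_left nhdsWithin_le_nhds) ?_
      filter_upwards [Ioc_mem_nhdsGT hlt] with t ht using hafter t ht
    · rwa [heq]
  have hnot : ∃ᶠ t in 𝓝[<] u, γ t ∉ J := by
    intro hev
    obtain ⟨l, hl, hls⟩ := mem_nhdsLT_iff_exists_Ioo_subset.1 hev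
    obtain ⟨t, htA, hlt⟩ := exists_lt_of_lt_csSup ⟨v, hvA⟩ hl
    rcases (le_csSup hAb htA).lt_or_eq with htu | htu
    · exact hls ⟨hlt, htu⟩ htA.2
    · exact htA.2 (htu ▸ huJ)
  have hue := hJe huJ
  obtain ⟨a, hau, hleft⟩ := hγ.exists_sliding_left hr hue
  set w := Z.slidingField (γ u) with hw
  have hw0 : w ≠ 0 := slidingField_ne_zero hr hau (fun t ht => (hleft t ht).2) hue
    (hnot.mono fun t ht heq => ht (heq ▸ huJ))
  obtain ⟨N, hN, hinj⟩ := exists_injOn_inner hr hue.1 hw0 (inner_gradient_slidingField _)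
  -- The local coordinate on `Σ` is `⟪w, ·⟫`; it increases along the sliding flow through `γ u`, at
  -- rate `‖w‖²` there.
  have hπ : Continuous fun q : Plane => inner ℝ w q := by fun_prop
  have hww : 0 < inner ℝ w w := real_inner_self_pos.2 hw0
  obtain ⟨t₀, ht₀⟩ := h.surjective ⟨γ u, huJ⟩
  have ht₀' : (h t₀ : Plane) = γ u := congrArg Subtype.val ht₀
  have hder : ∀ {c : ℝ → Plane} {I : Set ℝ} {t : ℝ}, HasDerivWithinAt c w I t →
      HasDerivWithinAt (fun t => inner ℝ w (c t)) (inner ℝ w w) I t := by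
    intro c I t hc
    simpa using (hasDerivWithinAt_const t I w).inner ℝ hc
  have hlt : ∀ᶠ t in 𝓝[<] u, inner ℝ w (γ t) < inner ℝ w (h t₀ : Plane) := by
    have h1 := hder ((hleft u (right_mem_Icc.2 hau.le)).2.mono Ioo_subset_Icc_self)
    rw [hasDerivWithinAt_iff_tendsto_slope' right_notMem_Ioo, nhdsWithin_Ioo_eq_nhdsLT hau] at h1
    filter_upwards [h1.eventually (eventually_gt_nhds hww), self_mem_nhdsWithin] with t h2 h3
    rw [slope_def_field] at h2
    rw [ht₀']
    have h4 : t - u < 0 := sub_neg.2 h3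
    by_contra h5
    exact absurd h2 (not_lt.2 (div_nonpos_of_nonneg_of_nonpos (by linarith) h4.le))
  obtain ⟨hend, c, hc, hright⟩ := arc_end_of_frequently_notMem (S := Z.switching) (h := h)
    (t₀ := t₀) hπ (by rwa [ht₀']) hinj (fun q hq => (hJe hq).1) hcont.continuousAt ht₀'.symm
    (by filter_upwards [Ioo_mem_nhdsLT hau] with t ht using
      (hleft t (Ioo_subset_Icc_self ht)).1.1) hlt hnot
  refine ⟨γ u, ?_, ?_, reachesByEscape_of_isGlobalTrajectory hγ hs₀u (hJe hs₀) ⟨s₁, hs₁, hout⟩⟩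
  · rw [← ht₀']
    rcases hend with rfl | rfl
    exacts [.inl rfl, .inr rfl]
  · rw [ht₀'] at hc hright
    -- The forward orbit moves to larger values of the coordinate, the side on which `J` fills `Σ`
    -- near its end.
    obtain ⟨σ, hσ0, δ, hδ, hσ⟩ := exists_sliding_orbit hr hue
    have hσ00 := (hσ 0 (left_mem_Icc.2 hδ.le)).2
    have hσc : ContinuousAt σ 0 := hσ00.continuousAt
    have hgt : ∀ᶠ t in 𝓝[>] (0 : ℝ), inner ℝ w (γ u) < inner ℝ w (σ t) := by
      rw [hσ0] at hσ00
      have h1 := hder (hσ00.hasDerivWithinAt (s := Ioi 0))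
      rw [hasDerivWithinAt_iff_tendsto_slope' self_notMem_Ioi] at h1
      filter_upwards [h1.eventually (eventually_gt_nhds hww), self_mem_nhdsWithin] with t h2 h3
      rw [slope_def_field, hσ0, sub_zero] at h2
      have := (div_pos_iff_of_pos_right h3).1 h2
      linarith
    have hltc : ∀ᶠ t in 𝓝[>] (0 : ℝ), inner ℝ w (σ t) < c :=
      ((hπ.continuousAt.comp hσc).eventually (gt_mem_nhds (by
        rw [Function.comp_apply, hσ0]; exact hc))).filter_mono nhdsWithin_le_nhds
    have hσN : ∀ᶠ t in 𝓝[>] (0 : ℝ), σ t ∈ N :=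
      (hσc.eventually_mem (hσ0 ▸ hN)).filter_mono nhdsWithin_le_nhds
    have hmem : ∀ᶠ t in 𝓝[>] (0 : ℝ), σ t ∈ J := by
      filter_upwards [hgt, hltc, hσN, Ioc_mem_nhdsGT hδ] with t h1 h2 h3 h4
      exact hright _ ⟨h3, (hσ t (Ioc_subset_Icc_self h4)).1.1⟩ h1.le h2.le
    obtain ⟨δ', hδ', hsub⟩ := mem_nhdsGT_iff_exists_Ioc_subset.1 hmem
    have hmin : 0 < min δ δ' := lt_min hδ hδ'
    have hIcc : Icc 0 (min δ δ') ⊆ Icc 0 δ := Icc_subset_Icc_right (min_le_left _ _)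
    refine ⟨σ, hσ0, min δ δ', hmin, isSlidingArc_of_hasDerivWithinAt hr
      (fun t ht => (hσ t (hIcc ht)).1) (fun t ht => (hσ t (hIcc ht)).2.hasDerivWithinAt), ?_⟩
    intro t ht
    rcases ht.1.eq_or_lt with rfl | h0
    · rwa [hσ0]
    · exact hsub ⟨h0, ht.2.trans (min_le_right _ _)⟩

end NSVF

/-! ### Entropy from coding by words -/

/-- A lower bound of the topological entropy: infinite entropy by coding arbitrarily many symbols
at a bounded time cost. -/
theorem coverEntropy_eq_top_of_words {X : Type*} [PseudoMetricSpace X] (T : X → X) {M : ℕ}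
    (hM : 0 < M) (H : ∀ N : ℕ, 0 < N → ∃ ε > 0, ∀ k : ℕ, ∃ φ : (Fin k → Fin N) → X,
      ∀ w w', w ≠ w' → ∃ m < k * M, ε ≤ dist (T^[m] (φ w)) (T^[m] (φ w'))) :
    Dynamics.coverEntropy T univ = ⊤ := by
  classical
  have key : ∀ N : ℕ, 0 < N →
      ((Real.log N / M : ℝ) : EReal) ≤ Dynamics.coverEntropy T univ := by
    intro N hN
    obtain ⟨ε, hε, hφ⟩ := H N hN
    have hU : {p : X × X | dist p.1 p.2 < ε / 2} ∈ uniformity X :=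
      Metric.dist_mem_uniformity (half_pos hε)
    rw [Dynamics.coverEntropy_eq_iSup_netEntropyEntourage]
    refine le_trans ?_ (le_iSup₂ (f := fun U (_ : U ∈ uniformity X) =>
      Dynamics.netEntropyEntourage T univ U) _ hU)
    -- The growth rate is a limsup, so the times `n * M` suffice.
    refine Frequently.le_expGrowthSup ?_
    rw [frequently_atTop]
    intro n
    refine ⟨n * M, Nat.le_mul_of_pos_right n hM, ?_⟩
    obtain ⟨φ, hφ⟩ := hφ n
    have hinj : Function.Injective φ := by
      intro w w' h
      by_contra hne
      obtain ⟨m, -, hm⟩ := hφ w w' hne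
      rw [h, dist_self] at hm
      exact absurd hε (not_lt.2 hm)
    -- Points `ε`-separated along their orbits have disjoint dynamical balls of radius `ε / 2`.
    have hnet : Dynamics.IsDynNetIn T univ {p : X × X | dist p.1 p.2 < ε / 2} (n * M)
        (↑(Finset.univ.image φ) : Set X) := by
      refine ⟨subset_univ _, ?_⟩
      rw [Finset.coe_image, Finset.coe_univ, image_univ]
      rintro _ ⟨w, rfl⟩ _ ⟨w', rfl⟩ hne
      obtain ⟨m, hm, hd⟩ := hφ w w' fun h => hne (h ▸ rfl)
      refine Set.disjoint_left.2 fun z hz hz' => ?_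
      have h1 : dist (T^[m] (φ w)) (T^[m] z) < ε / 2 :=
        Dynamics.mem_ball_dynEntourage.1 hz m hm
      have h2 : dist (T^[m] (φ w')) (T^[m] z) < ε / 2 :=
        Dynamics.mem_ball_dynEntourage.1 hz' m hm
      linarith [dist_triangle_right (T^[m] (φ w)) (T^[m] (φ w')) (T^[m] z)]
    have hcard := hnet.card_le_netMaxcard
    rw [Finset.card_image_of_injective _ hinj] at hcard
    simp only [Finset.card_univ, Fintype.card_pi, Fintype.card_fin, Finset.prod_const] at hcard
    have hN' : (0 : ℝ) < N := by exact_mod_cast hN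
    have hM' : (M : ℝ) ≠ 0 := by exact_mod_cast hM.ne'
    have hexp : EReal.exp (((Real.log N / M : ℝ) : EReal) * ((n * M : ℕ) : EReal)) =
        ((N ^ n : ℕ) : ENNReal) := by
      have : ((Real.log N / M : ℝ) : EReal) * ((n * M : ℕ) : EReal) =
          ((Real.log (N ^ n) : ℝ) : EReal) := by
        rw [show ((n * M : ℕ) : EReal) = (((n * M : ℕ) : ℝ) : EReal) by norm_cast,
          ← EReal.coe_mul, Real.log_pow]
        congr 1
        push_cast
        field_simp
      rw [this, EReal.exp_coe, Real.exp_log (by positivity), ← ENNReal.ofReal_natCast]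
      norm_cast
    rw [hexp]
    exact_mod_cast hcard
  rw [EReal.eq_top_iff_forall_lt]
  intro y
  obtain ⟨N, hN⟩ := exists_nat_gt (Real.exp (M * y))
  have hN0 : (0 : ℝ) < N := (Real.exp_pos _).trans hN
  refine lt_of_lt_of_le ?_ (key N (by exact_mod_cast hN0))
  rw [EReal.coe_lt_coe_iff, lt_div_iff₀ (by exact_mod_cast hM), mul_comm]
  exact (Real.lt_log_iff_exp_lt hN0).2 hN

/-! ### Iterates of the time-one map and the metric on trajectories -/

namespace NSVF

variable {r : ℕ∞} {Z : NSVF r}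

theorem Orbits.timeOne_iterate {K : Compacts Plane} (γ : Z.Orbits K) (m : ℕ) (t : ℝ) :
    (Orbits.timeOne^[m] γ).1 t = γ.1 (t + m) := by
  induction m generalizing t with
  | zero => simp
  | succ m ih =>
    rw [Function.iterate_succ_apply']
    change (Orbits.timeOne^[m] γ).1 (t + 1) = _
    rw [ih, add_assoc, Nat.cast_succ, add_comm (m : ℝ)]

/-- Only the terms `0` and `1` of the series are kept, with weights `1` and `1 / 2`. Two unit
intervals are needed because an interval of length at most `1` may straddle an integer. -/
theorem Orbits.half_integral_le_dist_iterate {K : Compacts Plane} (γ η : Z.Orbits K) {m : ℕ}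
    {a b : ℝ} (hma : m ≤ a) (hab : a ≤ b) (hbm : b ≤ m + 2) :
    (1 / 2) * ∫ t in a..b, dist (γ.1 t) (η.1 t) ≤
      dist (Orbits.timeOne^[m] γ) (Orbits.timeOne^[m] η) := by
  set γ' := Orbits.timeOne^[m] γ
  set η' := Orbits.timeOne^[m] η
  have h1 := (summable_rho γ' η').sum_le_tsum {0, 1}
    fun i _ => mul_nonneg (by positivity) (integral_dist_nonneg γ' η' i)
  have h2 : ∫ t in (0 : ℝ)..2, dist (γ'.1 t) (η'.1 t) =
      ∫ t in (m : ℝ)..(m + 2), dist (γ.1 t) (η.1 t) := by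
    simp only [γ', η', timeOne_iterate]
    rw [intervalIntegral.integral_comp_add_right (fun t => dist (γ.1 t) (η.1 t)) (m : ℝ)]
    rw [zero_add, add_comm]
  have h3 : ∫ t in a..b, dist (γ.1 t) (η.1 t) ≤
      ∫ t in (m : ℝ)..(m + 2), dist (γ.1 t) (η.1 t) :=
    intervalIntegral.integral_mono_interval hma hab hbm
      (ae_of_all _ fun _ => dist_nonneg) (intervalIntegrable_dist γ η _ _)
  have h4 := intervalIntegral.integral_add_adjacent_intervals
    (intervalIntegrable_dist γ' η' 0 1) (intervalIntegrable_dist γ' η' 1 2)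
  have h5 := integral_dist_nonneg γ' η' 0
  rw [Finset.sum_pair (by norm_num)] at h1
  norm_num at h1 h5
  change _ ≤ rho γ' η'
  rw [rho]
  norm_num
  linarith

/-! ### Loops -/

theorem Chain.exists_glue {c₁ c₂ : ℝ → Plane} {T₁ T₂ : ℝ} (h₁ : Chain Z c₁ 0 T₁)
    (h₂ : Chain Z c₂ 0 T₂) (h : c₁ T₁ = c₂ 0) :
    ∃ c : ℝ → Plane, Chain Z c 0 (T₁ + T₂) ∧ (∀ s ≤ T₁, c s = c₁ s) ∧
      ∀ s ≥ 0, c (T₁ + s) = c₂ s := by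
  let c : ℝ → Plane := fun s => if s ≤ T₁ then c₁ s else c₂ (s - T₁)
  have hc₁ : ∀ s ≤ T₁, c s = c₁ s := fun s hs => if_pos hs
  have hc₂ : ∀ s ≥ 0, c (T₁ + s) = c₂ s := by
    intro s hs
    rcases hs.lt_or_eq with hlt | rfl
    · simp only [c]
      rw [if_neg (by linarith), add_sub_cancel_left]
    · rw [add_zero, hc₁ _ le_rfl, h]
  refine ⟨c, (h₁.congr fun s hs => hc₁ s hs.2).trans ?_, hc₁, hc₂⟩
  have := h₂.shift (-T₁)
  rw [zero_sub, neg_neg, sub_neg_eq_add, add_comm T₂] at this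
  refine this.congr fun t ht => ?_
  have := hc₂ (t - T₁) (sub_nonneg.2 ht.1)
  simpa [sub_eq_add_neg] using this

/-- Only the initial part of the first chain has to avoid `Σ^e`, so anything may be appended. -/
theorem ReachesByEscape.trans_chain {p q : Plane} (h : Z.ReachesByEscape p q) {c : ℝ → Plane}
    {T : ℝ} (hc : Chain Z c 0 T) (h0 : c 0 = q) : Z.ReachesByEscape p (c T) := by
  obtain ⟨c₁, T₁, h₁, h10, h1T, s, hs, hout⟩ := h
  obtain ⟨d, hd, hd₁, hd₂⟩ := h₁.exists_glue hc (h1T.trans h0.symm)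
  refine ⟨d, _, hd, by rw [hd₁ _ h₁.lt.le, h10], hd₂ T hc.lt.le, min s T₁, lt_min hs h₁.lt,
    fun t ht => ?_⟩
  rw [hd₁ t (ht.2.le.trans (min_le_right _ _))]
  exact hout t ⟨ht.1, ht.2.trans_le (min_le_left _ _)⟩

theorem ReachesByEscape.trans {p q q' : Plane} (h : Z.ReachesByEscape p q)
    (h' : Z.ReachesByEscape q q') : Z.ReachesByEscape p q' := by
  obtain ⟨c, T, hc, h0, hT, -⟩ := h'
  exact hT ▸ h.trans_chain hc h0

theorem IsSlidingArc.chain {σ : ℝ → Plane} {δ t : ℝ} (h : Z.IsSlidingArc σ 0 δ)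
    (h0 : σ 0 ∈ Z.escaping) (ht : t ∈ Ioc 0 δ) : Chain Z σ 0 t :=
  .single ht.1 (.escaping h0 (.inr (.inr (h.mono le_rfl ht.2))))

/-- There is a sliding orbit in `J` such that its starting point can be reached by escaping from
any of its other points. -/
theorem exists_recurrent_sliding_orbit (hr : 1 < r) {J : Set Plane} (h : unitInterval ≃ₜ J)
    (hJe : J ⊆ Z.escaping)
    (hret : ∀ x ∈ J, ∃ γ, Z.IsGlobalTrajectory γ ∧
      ∃ s₀, γ s₀ = x ∧ (Z.EscapesTo Z.pos γ s₀ ∨ Z.EscapesTo Z.neg γ s₀) ∧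
        ∃ s > s₀, γ s ∈ J) :
    ∃ σ : ℝ → Plane, ∃ δ > 0, Z.IsSlidingArc σ 0 δ ∧ (∀ t ∈ Icc 0 δ, σ t ∈ J) ∧
      ∀ t ∈ Ioc 0 δ, Z.ReachesByEscape (σ t) (σ 0) := by
  have H : ∀ x ∈ J, ∃ e : Plane, (e = h 0 ∨ e = h 1) ∧ Z.IsSlidingStart J e ∧
      Z.ReachesByEscape x e := by
    intro x hx
    obtain ⟨γ, hγ, s₀, rfl, hesc, s, hs, hsJ⟩ := hret x hx
    refine exists_return_to_end hr h hJe hγ hx ?_ hs hsJ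
    rcases hesc with ⟨-, s₁, hs₁, hout⟩ | ⟨-, s₁, hs₁, hout⟩ <;>
      exact ⟨s₁, hs₁, fun t ht hmem => (hout t ht).1 (subset_closure hmem)⟩
  have done : ∀ e, Z.IsSlidingStart J e → (∀ x ∈ J, Z.ReachesByEscape x e) →
      ∃ σ : ℝ → Plane, ∃ δ > 0, Z.IsSlidingArc σ 0 δ ∧ (∀ t ∈ Icc 0 δ, σ t ∈ J) ∧
        ∀ t ∈ Ioc 0 δ, Z.ReachesByEscape (σ t) (σ 0) := by
    rintro e ⟨σ, hσ0, δ, hδ, hσ, hσJ⟩ hx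
    exact ⟨σ, δ, hδ, hσ, hσJ, fun t ht => hσ0 ▸ hx _ (hσJ t (Ioc_subset_Icc_self ht))⟩
  by_cases ha : Z.IsSlidingStart J (h 0)
  · by_cases hb : Z.IsSlidingStart J (h 1)
    · obtain ⟨σ, hσ0, δ, hδ, hσ, hσJ⟩ := hb
      have hσe : σ 0 ∈ Z.escaping := hσ0 ▸ hJe (h 1).2
      -- If the orbit from `h 1` has a point leading back to `h 0`, then all of `J` leads to `h 0`,
      -- through `h 1` if necessary, and the orbit from `h 0` works. Otherwise each of its points
      -- leads back to `h 1`, and this orbit works.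
      by_cases hba : ∃ t ∈ Ioc 0 δ, Z.ReachesByEscape (σ t) (h 0)
      · obtain ⟨t, ht, hta⟩ := hba
        refine done _ ha fun x hx => ?_
        obtain ⟨e, rfl | rfl, -, hxe⟩ := H x hx
        · exact hxe
        · exact (hxe.trans_chain (hσ.chain hσe ht) hσ0).trans hta
      · refine ⟨σ, δ, hδ, hσ, hσJ, fun t ht => ?_⟩
        obtain ⟨e, rfl | rfl, -, hxe⟩ := H _ (hσJ t (Ioc_subset_Icc_self ht))
        · exact absurd ⟨t, ht, hxe⟩ hba
        · rwa [hσ0]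
    · refine done _ ha fun x hx => ?_
      obtain ⟨e, rfl | rfl, he, hxe⟩ := H x hx
      exacts [hxe, absurd he hb]
  · have hx : ∀ x ∈ J, Z.IsSlidingStart J (h 1) ∧ Z.ReachesByEscape x (h 1) := by
      intro x hx
      obtain ⟨e, rfl | rfl, he, hxe⟩ := H x hx
      exacts [absurd he ha, ⟨he, hxe⟩]
    exact done _ (hx _ (h 1).2).1 fun x hxJ => (hx x hxJ).2

/-- Two loops with a common start which differ on a set of positive measure of times before both
return. -/
def Separated (ε : ℝ) (c c' : ℝ → Plane) (T T' : ℝ) : Prop :=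
  ∃ a b, 0 ≤ a ∧ a < b ∧ b ≤ a + 1 ∧ b ≤ T ∧ b ≤ T' ∧ ε ≤ ∫ t in a..b, dist (c t) (c' t)

theorem Separated.symm {ε : ℝ} {c c' : ℝ → Plane} {T T' : ℝ} (h : Separated ε c c' T T') :
    Separated ε c' c T' T := by
  obtain ⟨a, b, h0, h1, h2, h3, h4, h5⟩ := h
  exact ⟨a, b, h0, h1, h2, h4, h3, by simpa only [dist_comm] using h5⟩

/-- A chain on `[0, T]` which coincides with `σ` until time `t`, and then leaves the escaping
region for some time before it closes up. -/
structure IsLoop (Z : NSVF r) (σ : ℝ → Plane) (t : ℝ) (c : ℝ → Plane) (T : ℝ) : Prop where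
  chain : Chain Z c 0 T
  lt : t < T
  eqOn : ∀ s ∈ Icc 0 t, c s = σ s
  closed : c T = σ 0
  escapes : ∃ s > 0, ∀ u ∈ Ioo t (t + s), c u ∉ Z.escaping

theorem exists_isLoop {σ : ℝ → Plane} {δ t : ℝ} (h : Z.IsSlidingArc σ 0 δ)
    (h0 : σ 0 ∈ Z.escaping) (ht : t ∈ Ioc 0 δ) (hret : Z.ReachesByEscape (σ t) (σ 0)) :
    ∃ c T, IsLoop Z σ t c T := by
  obtain ⟨c₁, T₁, h₁, h10, h1T, s, hs, hout⟩ := hret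
  obtain ⟨c, hc, hc₁, hc₂⟩ := (h.chain h0 ht).exists_glue h₁ h10.symm
  refine ⟨c, t + T₁, hc, by linarith [h₁.lt], fun s hs => hc₁ s hs.2,
    (hc₂ T₁ h₁.lt.le).trans h1T, s, hs, fun u hu => ?_⟩
  have := hc₂ (u - t) (by linarith [hu.1])
  rw [add_sub_cancel] at this
  rw [this]
  exact hout _ ⟨by linarith [hu.1], by linarith [hu.2]⟩

/-- Just after `t` one loop is off `Σ^e` while the other still follows `σ` inside it. They differ
there, and by continuity the integral of their distance is positive. -/
theorem IsLoop.exists_separated {σ : ℝ → Plane} {t t' T T' δ : ℝ} {c c' : ℝ → Plane}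
    (h : IsLoop Z σ t c T) (h' : IsLoop Z σ t' c' T') (ht : 0 < t) (htt : t < t') (ht' : t' ≤ δ)
    (hσ : ∀ s ∈ Icc 0 δ, σ s ∈ Z.escaping) : ∃ ε > 0, Separated ε c c' T T' := by
  obtain ⟨s, hs, hout⟩ := h.escapes
  obtain ⟨b, htb, hb⟩ := exists_between (lt_min (lt_min (lt_add_of_pos_right t hs) h.lt)
    (lt_min htt (lt_add_one t)))
  rw [lt_min_iff, lt_min_iff, lt_min_iff] at hb
  obtain ⟨⟨hbs, hbT⟩, hbt, hb1⟩ := hb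
  have hbT' : b ≤ T' := hbt.le.trans h'.lt.le
  refine ⟨_, ?_, t, b, ht.le, htb, hb1.le, hbT.le, hbT', le_rfl⟩
  refine intervalIntegral.integral_pos htb ?_ (fun _ _ => dist_nonneg)
    ⟨b, right_mem_Icc.2 htb.le, dist_pos.2 fun heq => ?_⟩
  · exact continuous_dist.comp_continuousOn
      ((h.chain.continuousOn.mono (Icc_subset_Icc ht.le hbT.le)).prodMk
        (h'.chain.continuousOn.mono (Icc_subset_Icc ht.le hbT')))
  · refine hout b ⟨htb, hbs⟩ (heq ▸ ?_)
    rw [h'.eqOn b ⟨ht.le.trans htb.le, hbt.le⟩]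
    exact hσ b ⟨ht.le.trans htb.le, hbt.le.trans ht'⟩

/-- Words in finitely many pairwise separated loops are realized by separated trajectories. -/
theorem exists_orbits_of_words {K : Compacts Plane} (hK : Z.IsInvariant K) {e : Plane}
    (he : e ∈ K) {N M : ℕ} (hN : 0 < N) {c : Fin N → ℝ → Plane} {T : Fin N → ℝ}
    (hc : ∀ i, Chain Z (c i) 0 (T i)) (h0 : ∀ i, c i 0 = e) (h1 : ∀ i, c i (T i) = e)
    (hT : ∀ i, T i ≤ M) {ε : ℝ}
    (hsep : ∀ i j, i ≠ j → Separated ε (c i) (c j) (T i) (T j)) (k : ℕ) :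
    ∃ φ : (Fin k → Fin N) → Z.Orbits K, ∀ w w', w ≠ w' → ∃ m < k * M,
      ε / 2 ≤ dist (Orbits.timeOne^[m] (φ w)) (Orbits.timeOne^[m] (φ w')) := by
  have : Nonempty (Fin N) := ⟨⟨0, hN⟩⟩
  -- The shortest loop gives the positive lower bound on durations; it also pads the words to
  -- bi-infinite sequences.
  obtain ⟨i₀, hi₀⟩ := Finite.exists_min T
  let W : (Fin k → Fin N) → ℤ → Fin N := fun w j =>
    if h : 0 ≤ j ∧ j < k then w ⟨j.toNat, by omega⟩ else i₀
  have hW : ∀ (w : Fin k → Fin N) (j : Fin k), W w (j : ℕ) = w j := by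
    intro w j
    simp [W]
  choose γ τ hγ hτ0 hτ hγτ using fun w : Fin k → Fin N =>
    exists_concatenation (c := fun j => c (W w j)) (T := fun j => T (W w j)) (e := e)
      (hc i₀).lt (fun j => hi₀ _) (fun j => h0 _) (fun j => h1 _) fun j => hc _
  have hγ0 : ∀ w, γ w 0 = e := by
    intro w
    have := hγτ w 0 0 (left_mem_Icc.2 (hc _).lt.le)
    rw [hτ0, add_zero] at this
    exact this.trans (h0 _)
  refine ⟨fun w => ⟨γ w, hγ w, hK e he _ (hγ w) ⟨0, hγ0 w⟩⟩, fun w w' hne => ?_⟩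
  have hex : ∃ j, ∃ h : j < k, w ⟨j, h⟩ ≠ w' ⟨j, h⟩ := by
    by_contra! hall
    exact hne (funext fun j => hall j j.2)
  classical
  obtain ⟨hjk, hj⟩ := Nat.find_spec hex
  set j := Nat.find hex
  have hbefore : ∀ i < j, W w (i : ℕ) = W w' (i : ℕ) := by
    intro i hi
    have := Nat.find_min hex hi
    push Not at this
    have hik : i < k := hi.trans hjk
    rw [hW w ⟨i, hik⟩, hW w' ⟨i, hik⟩, this hik]
  -- Up to the first differing letter `j` the durations agree, so both trajectories start their
  -- `j`-th loop at the same time.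
  have hττ : ∀ i : ℕ, i ≤ j → τ w i = τ w' i := by
    intro i
    induction i with
    | zero => intro _; simp [hτ0]
    | succ i ih =>
      intro hi
      push_cast
      rw [hτ, hτ, ih (by omega), hbefore i (by omega)]
  have hτnn : ∀ i : ℕ, 0 ≤ τ w i ∧ τ w i ≤ i * M := by
    intro i
    induction i with
    | zero => simp [hτ0]
    | succ i ih =>
      push_cast
      rw [hτ]
      exact ⟨add_nonneg ih.1 (hc _).lt.le, by linarith [ih.2, hT (W w i)]⟩
  obtain ⟨a, b, ha, hab, hb1, hbT, hbT', hint⟩ := hsep _ _ hj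
  have hlt := hab
  replace hab := hab.le
  have hann : 0 ≤ τ w j + a := add_nonneg (hτnn j).1 ha
  have heq : ∀ s ∈ Icc a b, γ w (τ w j + s) = c (w ⟨j, hjk⟩) s := by
    intro s hs
    have := hγτ w j s
    rw [hW w ⟨j, hjk⟩] at this
    exact this ⟨ha.trans hs.1, hs.2.trans hbT⟩
  have heq' : ∀ s ∈ Icc a b, γ w' (τ w j + s) = c (w' ⟨j, hjk⟩) s := by
    intro s hs
    have := hγτ w' j s
    rw [hW w' ⟨j, hjk⟩, ← hττ j le_rfl] at this
    exact this ⟨ha.trans hs.1, hs.2.trans hbT'⟩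
  have hcong : ∫ t in (τ w j + a)..(τ w j + b), dist (γ w t) (γ w' t) =
      ∫ t in a..b, dist (c (w ⟨j, hjk⟩) t) (c (w' ⟨j, hjk⟩) t) := by
    rw [← intervalIntegral.integral_comp_add_left (fun t => dist (γ w t) (γ w' t))]
    refine intervalIntegral.integral_congr fun s hs => ?_
    rw [uIcc_of_le hab] at hs
    simp only [heq s hs, heq' s hs]
  have hm := Nat.floor_le hann
  have hm' := Nat.lt_floor_add_one (τ w j + a)
  -- This time is below `k * M` since `τ w j ≤ j * M` and `a < b ≤ M`; as `b ≤ a + 1`, the interval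
  -- of separation fits in the two units that follow.
  refine ⟨⌊τ w j + a⌋₊, ?_, ?_⟩
  · have h2 : ((j : ℝ) + 1) * M ≤ k * M :=
      mul_le_mul_of_nonneg_right (by exact_mod_cast hjk) (Nat.cast_nonneg M)
    have h3 : (⌊τ w j + a⌋₊ : ℝ) < k * M := by
      linarith [(hτnn j).2, hT (w ⟨j, hjk⟩)]
    exact_mod_cast h3
  · refine le_trans ?_ (Orbits.half_integral_le_dist_iterate _ _ (a := τ w j + a)
      (b := τ w j + b) hm (by linarith) (by linarith))
    rw [hcong]
    linarith

end NSVF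

/-! ### Infinite entropy -/

theorem mainTheorem2 {r : ℕ∞} (hr : 1 < r) (Z : NSVF r) (K : Compacts Plane)
    (hKU : (K : Set Plane) ⊆ Z.U) (hK : Z.IsInvariant K)
    (hne : (Z.escaping ∩ K).Nonempty)
    (J : Set Plane) (hJ : Nonempty (unitInterval ≃ₜ J)) (hJe : J ⊆ Z.escaping ∩ K)
    (hret : ∀ x ∈ J, ∃ γ, Z.IsGlobalTrajectory γ ∧
      ∃ s₀, γ s₀ = x ∧ (Z.EscapesTo Z.pos γ s₀ ∨ Z.EscapesTo Z.neg γ s₀) ∧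
        ∃ s > s₀, γ s ∈ J) :
    Z.entropy K = ⊤ := by
  obtain ⟨h⟩ := hJ
  obtain ⟨σ, δ, hδ, hσ, hσJ, hrec⟩ := NSVF.exists_recurrent_sliding_orbit hr h
    (fun q hq => (hJe hq).1) hret
  have hσe : ∀ t ∈ Icc 0 δ, σ t ∈ Z.escaping := fun t ht => (hJe (hσJ t ht)).1
  have h0 : (0 : ℝ) ∈ Icc 0 δ := left_mem_Icc.2 hδ.le
  choose! c T hloop using fun t (ht : t ∈ Ioc 0 δ) =>
    NSVF.exists_isLoop hσ (hσe 0 h0) ht (hrec t ht)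
  -- No bound on the return times is known. If each bound held for only finitely many `t`, the
  -- interval would be countable.
  obtain ⟨M, hM⟩ : ∃ M : ℕ, {t ∈ Ioc 0 δ | T t ≤ M}.Infinite := by
    by_contra! hfin
    refine (Cardinal.Real.Ioc_countable_iff.not.2 (not_le.2 hδ) :
      ¬ (Ioc 0 δ).Countable) ((countable_iUnion fun M : ℕ =>
        (hfin M).countable).mono fun t ht => ?_)
    obtain ⟨M, hM⟩ := exists_nat_ge (T t)
    exact mem_iUnion.2 ⟨M, ht, hM⟩
  have hM0 : 0 < M := by
    obtain ⟨t, ht, htM⟩ := hM.nonempty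
    exact_mod_cast (ht.1.trans (hloop t ht).lt).trans_le htM
  refine coverEntropy_eq_top_of_words _ hM0 fun N hN => ?_
  obtain ⟨F, hF, hFN⟩ := hM.exists_subset_card_eq N
  let t : Fin N ≃ F := (F.equivFinOfCardEq hFN).symm
  have ht : ∀ i, (t i : ℝ) ∈ Ioc 0 δ ∧ T (t i) ≤ M := fun i => hF (t i).2
  have hsep : ∀ p : Fin N × Fin N, ∃ ε > 0, p.1 ≠ p.2 →
      NSVF.Separated ε (c (t p.1)) (c (t p.2)) (T (t p.1)) (T (t p.2)) := by
    rintro ⟨i, j⟩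
    rcases lt_trichotomy (t i : ℝ) (t j) with hlt | heq | hlt
    · obtain ⟨ε, hε, hs⟩ := (hloop _ (ht i).1).exists_separated (hloop _ (ht j).1)
        (ht i).1.1 hlt (ht j).1.2 hσe
      exact ⟨ε, hε, fun _ => hs⟩
    · exact ⟨1, one_pos, fun hij => absurd (t.injective (Subtype.ext heq)) hij⟩
    · obtain ⟨ε, hε, hs⟩ := (hloop _ (ht j).1).exists_separated (hloop _ (ht i).1)
        (ht j).1.1 hlt (ht i).1.2 hσe
      exact ⟨ε, hε, fun _ => hs.symm⟩
  choose ε hε hs using hsep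
  have : Nonempty (Fin N) := ⟨⟨0, hN⟩⟩
  -- The separation may shrink as `N` grows; only `M` has to be independent of `N`.
  obtain ⟨p, hp⟩ := Finite.exists_min ε
  refine ⟨ε p / 2, half_pos (hε p), NSVF.exists_orbits_of_words hK (hJe (hσJ 0 h0)).2 hN
    (c := fun i => c (t i)) (T := fun i => T (t i)) (fun i => (hloop _ (ht i).1).chain)
    (fun i => (hloop _ (ht i).1).eqOn 0 ⟨le_rfl, (ht i).1.1.le⟩)
    (fun i => (hloop _ (ht i).1).closed) (fun i => (ht i).2) fun i j hij => ?_⟩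
  obtain ⟨a, b, h1, h2, h3, h4, h5, h6⟩ := hs (i, j) hij
  exact ⟨a, b, h1, h2, h3, h4, h5, (hp _).trans h6⟩
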